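/- Let $p\ge 2$ be an integer and $\omega=e^{\pi i/(p+1)}$. For an integer $0\le \ell\le p+1$ let $\mathcal C(\omega^\ell)=\mathbb R_+\omega^{\ell}\cup\mathbb R_+\omega^{-\ell}$, oriented counter-clockwise, i.e. coming in from infinity to $0$ along $\mathbb R_+\omega^{-\ell}$ and going out from $0$ to infinity along $\mathbb R_+\omega^{\ell}$; if $\omega^\ell=\pm1$ this set is a single ray, oriented outwards. Let $\Gamma_p^+$ be the union of any finite set of distinct contours $\mathcal C(\omega^{2j})$, $0\le j\le[\frac{p+1}2]$, and $\Gamma_p^-$ the union of any finite set of distinct contours $\mathcal C(\omega^{2j+1})$, $0\le j\le[\frac p2]$, and set $$\Phi_p^\pm(u)=\sqrt{\pm\tfrac{p}{2\pi}}\int_{\Gamma_p^\pm}e^{\mp\frac{y^{p+1}}{p+1}\pm uy}\,dy,\qquad u\in\mathbb C,$$ where $\sqrt{-p/2\pi}=i\sqrt{p/2\pi}$. These integrals converge absolutely. There are complex numbers $a_i^\pm$, $i\ge[\frac{p+2}2]$, depending only on $p$ and on the sign $\pm$ (not on $\Gamma_p^\pm$ and not on the sector), such that for every ray $R$ contained in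 one of the chosen contours $\mathcal C(\omega^{2j})\subset\Gamma_p^+$, respectively $\mathcal C(\omega^{2j+1})\subset\Gamma_p^-$, $$\Phi_p^\pm(z^p)=\varepsilon\, z^{-\frac{p-1}2}\,e^{\pm\frac{p}{p+1}z^{p+1}}\Bigl(1+\sum_{i\ge[\frac{p+2}2]}\frac{a_i^\pm}{z^i}\Bigr)$$ as an asymptotic expansion for $z\to\infty$ in the open sector of angle $\frac{2\pi}{p(p+1)}$ centered about $R$, uniformly in every closed subsector (that is, for every $N$, the remainder after the terms $z^{-i}$ with $i<N$ in the bracket is $O(z^{-N})$). Here $z^{-(p-1)/2}$ is defined by the continuous branch of $\arg z$ in the sector that takes on $R$ the value $\frac{\pi\ell}{p+1}$ if $R=\mathbb R_+\omega^{\ell}$, and the value $-\frac{\pi\ell}{p+1}$ if $R=\mathbb R_+\omega^{-\ell}$ with $\omega^\ell\neq\pm1$, where $\ell=2j$, respectively $\ell=2j+1$. The constant $\varepsilon=\pm1$ depends only on the orientation of the ray: for $\Phi_p^+$, $\varepsilon=(-1)^j$ if $R=\mathbb R_+\omega^{2j}$ and $\varepsilon=(-1)^{j+1}$ if $R=\mathbb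 R_+\omega^{-2j}$ with $\omega^{2j}\neq\pm1$; for $\Phi_p^-$, $\varepsilon=(-1)^{j+1}$ on both rays. -/

import Mathlib

open Complex MeasureTheory Filter Asymptotics Set

noncomputable section

namespace AiryLike

/-- The superscript `±`. -/
inductive Sgn where
  | plus
  | minus

/-- `±1` as a complex number. -/
def Sgn.val : Sgn → ℂ
  | .plus => 1
  | .minus => -1

/-- The exponents `ℓ` of the contours `C(ω^ℓ)`: `ℓ = 2j` for `+`, `ℓ = 2j+1` for `-`. -/
def Sgn.exponent : Sgn → ℕ → ℕ
  | .plus, j => 2 * j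
  | .minus, j => 2 * j + 1

/-- The largest admissible index `j`: `⌊(p+1)/2⌋` for `+`, `⌊p/2⌋` for `-`. -/
def Sgn.maxIndex : Sgn → ℕ → ℕ
  | .plus, p => (p + 1) / 2
  | .minus, p => p / 2

/-- The angle `π ℓ / (p+1)` of `ω^ℓ`, where `ω = exp(π i / (p+1))`. -/
def rayAngle (p ℓ : ℕ) : ℝ := Real.pi * ℓ / (p + 1)

/-- The integrand `exp(∓ y^(p+1)/(p+1) ± u y)`. -/
def integrand (s : Sgn) (p : ℕ) (u y : ℂ) : ℂ :=
  exp (-s.val * (y ^ (p + 1) / (p + 1)) + s.val * (u * y))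

/-- The integrand pulled back to the ray of angle `φ`, parametrized by `y = r e^{iφ}`, `r > 0`. -/
def rayIntegrand (s : Sgn) (p : ℕ) (u : ℂ) (φ r : ℝ) : ℂ :=
  integrand s p u (r * exp (φ * I)) * exp (φ * I)

/-- The integral over the ray of angle `φ`, from `0` to infinity. -/
def rayIntegral (s : Sgn) (p : ℕ) (u : ℂ) (φ : ℝ) : ℂ :=
  ∫ r in Ioi (0 : ℝ), rayIntegrand s p u φ r

/-- `ω^ℓ` is real, so that the two rays of `C(ω^ℓ)` coincide (for `0 ≤ ℓ ≤ p + 1`). -/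
def Degenerate (p ℓ : ℕ) : Prop := ℓ = 0 ∨ ℓ = p + 1

open Classical in
/-- The integral over `C(ω^ℓ) = ℝ₊ ω^ℓ ∪ ℝ₊ ω^{-ℓ}`, oriented counter-clockwise: coming in from
infinity along the ray of `ω^{-ℓ}` and going out to infinity along the ray of `ω^ℓ`.
If `ω^ℓ` is real the point set is a single ray, oriented outwards. -/
def contourIntegral (s : Sgn) (p : ℕ) (u : ℂ) (ℓ : ℕ) : ℂ :=
  if Degenerate p ℓ then rayIntegral s p u (rayAngle p ℓ)
  else rayIntegral s p u (rayAngle p ℓ) - rayIntegral s p u (-rayAngle p ℓ)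

/-- `Φ_p^±(u)` for the contour `Γ_p^±` made of the `C(ω^ℓ)`, `ℓ = 2j` resp. `2j+1`, with `j ∈ J`.
The square root is the principal one, `√(-p/2π) = i √(p/2π)`. -/
def Phi (s : Sgn) (p : ℕ) (J : Finset ℕ) (u : ℂ) : ℂ :=
  (s.val * p / (2 * Real.pi)) ^ (1 / 2 : ℂ) * ∑ j ∈ J, contourIntegral s p u (s.exponent j)

/-- The open sector with bisecting ray of angle `φ` and half-opening `α` (used for `α ≤ π`). -/
def openSector (φ α : ℝ) : Set ℂ := {z | z ≠ 0 ∧ |arg (z * exp (-(φ * I)))| < α}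

/-- The closed sector with bisecting ray of angle `φ` and half-opening `δ`. -/
def closedSector (φ δ : ℝ) : Set ℂ := {z | z ≠ 0 ∧ |arg (z * exp (-(φ * I)))| ≤ δ}

/-- The power `z^c` near the ray of angle `φ`, with the branch of `arg z` that equals `φ` on it. -/
def branchPow (φ : ℝ) (c z : ℂ) : ℂ := exp (c * (log (z * exp (-(φ * I))) + φ * I))

/-- `F(z) ∼ ∑ a_i z^{-i}` as `z → ∞` in the open sector of half-opening `α` about the ray of
angle `φ`, uniformly in every closed subsector: every remainder after the terms `i < N`
is `O(z^{-N})`. -/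
def HasSectorExpansion (F : ℂ → ℂ) (a : ℕ → ℂ) (φ α : ℝ) : Prop :=
  ∀ δ < α, ∀ N : ℕ,
    (fun z => F z - ∑ i ∈ Finset.range N, a i / z ^ i)
      =O[Bornology.cobounded ℂ ⊓ 𝓟 (closedSector φ δ)] fun z => 1 / z ^ N

/-- `Φ(z^p) = ε z^{-(p-1)/2} e^{± p z^{p+1}/(p+1)} F(z)` with `F(z) ∼ ∑ a_i z^{-i}`,
in the sector of full angle `2π/(p(p+1))` centered about the ray of angle `φ`. -/
def HasAiryAsymptotics (s : Sgn) (p : ℕ) (Φ : ℂ → ℂ) (ε : ℂ) (a : ℕ → ℂ) (φ : ℝ) : Prop :=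
  ∃ F : ℂ → ℂ,
    (∀ z ∈ openSector φ (Real.pi / (p * (p + 1))),
      Φ (z ^ p) = ε * branchPow φ (-((p - 1) / 2)) z
        * exp (s.val * (p / (p + 1) * z ^ (p + 1))) * F z) ∧
    HasSectorExpansion F a φ (Real.pi / (p * (p + 1)))

/-- The orientation sign on the sector about the ray of `ω^ℓ`, `ℓ = 2j` resp. `2j+1`. -/
def Sgn.upperSign : Sgn → ℕ → ℂ
  | .plus, j => (-1) ^ j
  | .minus, j => (-1) ^ (j + 1)

/-- The orientation sign on the sector about the ray of `ω^{-ℓ}`, `ℓ = 2j` resp. `2j+1`. -/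
def Sgn.lowerSign : Sgn → ℕ → ℂ
  | .plus, j => (-1) ^ (j + 1)
  | .minus, j => (-1) ^ (j + 1)

end AiryLike

end

open AiryLike

open scoped Topology

namespace AiryLike

/-! This is the method of steepest descent on rays. On a ray of angle φ = πL/(p+1) with L of the
parity of the sign, e^{i(p+1)φ} = ±1, so every ray integral becomes e^{iφ} ∫₀^∞ exp(-r^{p+1}/(p+1) +
v r) dr with v = ±u e^{iφ} (`rayIntegral_eq`). For u = z^p and z = ζ e^{iφ}, the bisecting ray has v
= ζ^p, and the ray of exponent L + 2m has v = ζ^p e^{2πim/(p+1)} (`rayIntegral_pow_eq`).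

On the bisecting ray r = ζ is a saddle point. Turning the path onto the ray through ζ
(`rotatedIntegral_eq`) and putting r = ζw leaves ζ e^{pZ/(p+1)} ∫₀^∞ e^{-Z h(w)} dw, where Z =
ζ^{p+1} and h(w) = w^{p+1}/(p+1) - w + p/(p+1) is real and nonnegative, with a double zero at w = 1.
Laplace's method (`laplace_expansion`, `exists_saddle_coeff`) gives a series in 1/Z = ±z^{-(p+1)}
that depends on p alone, so `a i` vanishes unless p+1 divides i.

On any other ray, v has a different argument. Turning the path by ±δ and applying Young's inequality
makes that integral exponentially smaller (`exists_rotation`, `exists_norm_rotatedIntegral_le`); the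
limit δ < π/(p(p+1)) is exactly what this comparison needs. The signs ε come from e^{iφ} = e^{iπL/2}
e^{-i(p-1)φ/2}, the root √(±1) and the orientation. -/

/-! ### Absolute convergence and rotation of the path. -/

theorem norm_cexp_kernel_le {p : ℕ} (hp : 1 ≤ p) {a b : ℝ} (ha : 0 < a) {A B : ℂ}
    (hA : a ≤ A.re) (hB : B.re ≤ b) {r : ℝ} (hr : 0 ≤ r) :
    ‖cexp (-(A * (r : ℂ) ^ (p + 1)) + B * r)‖ ≤
      Real.exp (a + b ^ 2 / (2 * a)) * Real.exp (-(a / 2) * r ^ 2) := by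
  rw [norm_exp, ← Real.exp_add, Real.exp_le_exp]
  have h1 : (-(A * (r : ℂ) ^ (p + 1)) + B * r).re = -(A.re * r ^ (p + 1)) + B.re * r := by
    rw [← ofReal_pow, add_re, neg_re, re_mul_ofReal, re_mul_ofReal]
  rw [h1]
  -- Replacing r^{p+1} by r² - 1 makes every majorant a polynomial times a Gaussian; completing the
  -- square in `h6` absorbs the linear term.
  have h2 : r ^ 2 - 1 ≤ r ^ (p + 1) := by
    rcases le_total 1 r with h | h
    · have := pow_le_pow_right₀ h (show 2 ≤ p + 1 by omega)
      linarith
    · have : r ^ 2 ≤ 1 := pow_le_one₀ hr h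
      have := pow_nonneg hr (p + 1)
      linarith
  have h3 : a * r ^ (p + 1) ≤ A.re * r ^ (p + 1) := by gcongr
  have h4 : B.re * r ≤ b * r := by gcongr
  have h5 : a * (r ^ 2 - 1) ≤ a * r ^ (p + 1) := by gcongr
  have h6 : b * r ≤ b ^ 2 / (2 * a) + a / 2 * r ^ 2 := by
    have : b ^ 2 / (2 * a) + a / 2 * r ^ 2 - b * r = (b - a * r) ^ 2 / (2 * a) := by
      field_simp; ring
    have : 0 ≤ (b - a * r) ^ 2 / (2 * a) := by positivity
    linarith
  linarith

theorem integrable_pow_mul_gauss {b : ℝ} (hb : 0 < b) (n : ℕ) :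
    Integrable fun x : ℝ => x ^ n * Real.exp (-b * x ^ 2) := by
  have := integrable_rpow_mul_exp_neg_mul_sq hb (s := n) (by
    have : (0 : ℝ) ≤ n := n.cast_nonneg
    linarith)
  simpa using this

theorem integrableOn_kernel {p : ℕ} (hp : 1 ≤ p) {A : ℂ} (hA : 0 < A.re) (B : ℂ) :
    IntegrableOn (fun r : ℝ => cexp (-(A * (r : ℂ) ^ (p + 1)) + B * r)) (Ioi 0) := by
  have h := ((integrable_pow_mul_gauss (half_pos hA) 0).const_mul
    (Real.exp (A.re + B.re ^ 2 / (2 * A.re)))).integrableOn (s := Ioi 0)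
  refine h.mono' (Continuous.aestronglyMeasurable (by fun_prop)) ?_
  filter_upwards [ae_restrict_mem measurableSet_Ioi] with r hr
  have := norm_cexp_kernel_le hp hA (A := A) (B := B) le_rfl le_rfl (le_of_lt hr)
  simpa using this

/-- The integral `∫₀^∞ exp(-r^(p+1)/(p+1) + v r) dr`, taken along the ray of angle `β`. -/
noncomputable def rotatedIntegral (p : ℕ) (v : ℂ) (β : ℝ) : ℂ :=
  ∫ t in Ioi (0 : ℝ), cexp (β * I) *
    cexp (-((cexp (β * I) * t) ^ (p + 1) / (p + 1)) + v * (cexp (β * I) * t))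

theorem rotated_exponent (p : ℕ) (v : ℂ) (β t : ℝ) :
    -((cexp (β * I) * t) ^ (p + 1) / (p + 1)) + v * (cexp (β * I) * t) =
      -(cexp (((p + 1) * β : ℝ) * I) / (p + 1) * (t : ℂ) ^ (p + 1)) + v * cexp (β * I) * t := by
  have : cexp (β * I) ^ (p + 1) = cexp (((p + 1) * β : ℝ) * I) := by
    rw [← Complex.exp_nat_mul]; push_cast; ring_nf
  rw [mul_pow, this]; ring

theorem re_rotated_coeff (p : ℕ) (β : ℝ) :
    (cexp (((p + 1) * β : ℝ) * I) / (p + 1)).re = Real.cos ((p + 1) * β) / (p + 1) := by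
  have : ((p : ℂ) + 1) = ((p + 1 : ℝ) : ℂ) := by push_cast; rfl
  rw [this, div_ofReal_re, exp_ofReal_mul_I_re]

/-- The derivative of `t ↦ t e^{iβ} g(t e^{iβ})`, where `g` is the integrand. -/
noncomputable def rotatedDeriv (p : ℕ) (v : ℂ) (β t : ℝ) : ℂ :=
  cexp (β * I) * (1 + cexp (β * I) * t * (v - (cexp (β * I) * t) ^ p)) *
    cexp (-((cexp (β * I) * t) ^ (p + 1) / (p + 1)) + v * (cexp (β * I) * t))

theorem hasDerivAt_integrand_comp (p : ℕ) (v y : ℂ) :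
    HasDerivAt (fun y : ℂ => cexp (-(y ^ (p + 1) / (p + 1)) + v * y))
      ((v - y ^ p) * cexp (-(y ^ (p + 1) / (p + 1)) + v * y)) y := by
  have h1 : HasDerivAt (fun y : ℂ => -(y ^ (p + 1) / (p + 1)) + v * y) (v - y ^ p) y := by
    have h := ((hasDerivAt_pow (p + 1) y).div_const ((p : ℂ) + 1)).neg.add
      ((hasDerivAt_id y).const_mul v)
    refine HasDerivAt.congr_deriv h ?_
    have : (p : ℂ) + 1 ≠ 0 := by exact_mod_cast p.succ_ne_zero
    simp
    field_simp
    ring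
  simpa [mul_comm] using h1.cexp

/-- By holomorphy the angular derivative of the pulled-back integrand is I times the radial
derivative of y g(y), y = t e^{iβ}. It is thus exact in t, which takes the place of Cauchy's theorem
on a sector. -/
theorem hasDerivAt_rotated_angle (p : ℕ) (v : ℂ) (β t : ℝ) :
    HasDerivAt (fun β : ℝ => cexp (β * I) *
      cexp (-((cexp (β * I) * t) ^ (p + 1) / (p + 1)) + v * (cexp (β * I) * t)))
      (I * rotatedDeriv p v β t) β := by
  have h1 : HasDerivAt (fun β : ℝ => cexp (β * I)) (cexp (β * I) * I) β := by
    have := ((hasDerivAt_id (β : ℂ)).mul_const I).cexp.comp_ofReal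
    simpa using this
  have h2 := (hasDerivAt_integrand_comp p v (cexp (β * I) * t)).comp β (h1.mul_const (t : ℂ))
  refine HasDerivAt.congr_deriv (h1.mul h2) ?_
  simp only [rotatedDeriv]
  ring

theorem hasDerivAt_rotated_radius (p : ℕ) (v : ℂ) (β t : ℝ) :
    HasDerivAt (fun t : ℝ => cexp (β * I) * t *
      cexp (-((cexp (β * I) * t) ^ (p + 1) / (p + 1)) + v * (cexp (β * I) * t)))
      (rotatedDeriv p v β t) t := by
  have h1 : HasDerivAt (fun t : ℝ => cexp (β * I) * (t : ℂ)) (cexp (β * I)) t := by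
    simpa using (hasDerivAt_id (t : ℂ)).comp_ofReal.const_mul (cexp (β * I))
  have h2 := (hasDerivAt_integrand_comp p v (cexp (β * I) * t)).comp t h1
  refine HasDerivAt.congr_deriv (h1.mul h2) ?_
  simp only [rotatedDeriv]
  ring

theorem norm_rotated_le {p : ℕ} (hp : 1 ≤ p) (v : ℂ) {a β t : ℝ} (ha : 0 < a)
    (hβ : a ≤ Real.cos ((p + 1) * β) / (p + 1)) (ht : 0 ≤ t) :
    ‖cexp (-((cexp (β * I) * t) ^ (p + 1) / (p + 1)) + v * (cexp (β * I) * t))‖ ≤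
      Real.exp (a + ‖v‖ ^ 2 / (2 * a)) * Real.exp (-(a / 2) * t ^ 2) := by
  rw [rotated_exponent]
  refine norm_cexp_kernel_le hp ha ?_ ?_ ht
  · rw [re_rotated_coeff]; exact hβ
  · refine (re_le_norm _).trans ?_
    simp [norm_exp_ofReal_mul_I]

/-- A common integrable bound for `rotatedDeriv` and for `t e^{iβ} g(t e^{iβ})`. -/
noncomputable def rotatedBound (p : ℕ) (v : ℂ) (a t : ℝ) : ℝ :=
  Real.exp (a + ‖v‖ ^ 2 / (2 * a)) *
    ((t ^ 0 * Real.exp (-(a / 2) * t ^ 2) + ‖v‖ * (t ^ 1 * Real.exp (-(a / 2) * t ^ 2))) +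
      t ^ (p + 1) * Real.exp (-(a / 2) * t ^ 2))

theorem integrable_rotatedBound (p : ℕ) (v : ℂ) {a : ℝ} (ha : 0 < a) :
    Integrable (rotatedBound p v a) :=
  (((integrable_pow_mul_gauss (half_pos ha) 0).add
    ((integrable_pow_mul_gauss (half_pos ha) 1).const_mul _)).add
    (integrable_pow_mul_gauss (half_pos ha) (p + 1))).const_mul _

theorem norm_rotatedDeriv_le {p : ℕ} (hp : 1 ≤ p) (v : ℂ) {a β t : ℝ} (ha : 0 < a)
    (hβ : a ≤ Real.cos ((p + 1) * β) / (p + 1)) (ht : 0 ≤ t) :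
    ‖rotatedDeriv p v β t‖ ≤ rotatedBound p v a t := by
  have h1 := norm_rotated_le hp v ha hβ ht
  have h2 : ‖1 + cexp (β * I) * t * (v - (cexp (β * I) * t) ^ p)‖ ≤
      1 + ‖v‖ * t + t ^ (p + 1) := by
    refine (norm_add_le _ _).trans ?_
    rw [norm_mul, norm_mul, norm_exp_ofReal_mul_I, norm_real, Real.norm_of_nonneg ht, norm_one]
    have : ‖v - (cexp (β * I) * t) ^ p‖ ≤ ‖v‖ + t ^ p := by
      refine (norm_sub_le _ _).trans ?_
      rw [norm_pow, norm_mul, norm_exp_ofReal_mul_I, norm_real, Real.norm_of_nonneg ht, one_mul]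
    have := mul_le_mul_of_nonneg_left this ht
    have e : t * (‖v‖ + t ^ p) = ‖v‖ * t + t ^ (p + 1) := by ring
    linarith
  rw [rotatedDeriv, norm_mul, norm_mul, norm_exp_ofReal_mul_I, one_mul]
  refine (mul_le_mul h2 h1 (norm_nonneg _) (by positivity)).trans (le_of_eq ?_)
  simp only [rotatedBound]; ring

/-- The primitive y g(y) vanishes at 0 and at infinity. -/
theorem integral_rotatedDeriv {p : ℕ} (hp : 1 ≤ p) (v : ℂ) {β : ℝ}
    (hβ : 0 < Real.cos ((p + 1) * β)) :
    ∫ t in Ioi (0 : ℝ), rotatedDeriv p v β t = 0 := by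
  set a := Real.cos ((p + 1) * β) / (p + 1) with ha'
  have ha : 0 < a := by positivity
  have hF : IntegrableOn (fun t : ℝ => cexp (β * I) * t *
      cexp (-((cexp (β * I) * t) ^ (p + 1) / (p + 1)) + v * (cexp (β * I) * t))) (Ioi 0) := by
    refine (((integrable_pow_mul_gauss (half_pos ha) 1).const_mul
      (Real.exp (a + ‖v‖ ^ 2 / (2 * a)))).integrableOn).mono'
      (Continuous.aestronglyMeasurable (by fun_prop)) ?_
    filter_upwards [ae_restrict_mem measurableSet_Ioi] with t ht
    have ht : 0 < t := ht
    rw [norm_mul, norm_mul, norm_exp_ofReal_mul_I, norm_real, Real.norm_of_nonneg ht.le, one_mul]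
    refine (mul_le_mul_of_nonneg_left (norm_rotated_le hp v ha le_rfl ht.le) ht.le).trans
      (le_of_eq ?_)
    ring
  have hF' : IntegrableOn (rotatedDeriv p v β) (Ioi 0) := by
    refine ((integrable_rotatedBound p v ha).integrableOn).mono'
      (Continuous.aestronglyMeasurable (by unfold rotatedDeriv; fun_prop)) ?_
    filter_upwards [ae_restrict_mem measurableSet_Ioi] with t ht
    exact norm_rotatedDeriv_le hp v ha le_rfl (le_of_lt ht)
  have hlim := tendsto_zero_of_hasDerivAt_of_integrableOn_Ioi
    (fun t _ => hasDerivAt_rotated_radius p v β t) hF' hF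
  rw [integral_Ioi_of_hasDerivAt_of_tendsto
    (hasDerivAt_rotated_radius p v β 0).continuousAt.continuousWithinAt
    (fun t _ => hasDerivAt_rotated_radius p v β t) hF' hlim]
  simp

theorem cos_pos_of_abs_lt {p : ℕ} {β b : ℝ} (hb : |β| ≤ b)
    (hb' : b < Real.pi / (2 * (p + 1))) :
    0 < Real.cos ((p + 1) * b) ∧ Real.cos ((p + 1) * b) ≤ Real.cos ((p + 1) * β) := by
  have hp : (0 : ℝ) < p + 1 := by positivity
  have h0 : 0 ≤ b := (abs_nonneg _).trans hb
  have h1 : (p + 1) * b < Real.pi / 2 := by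
    rw [lt_div_iff₀ (by positivity)] at hb'
    linarith
  have h2 : 0 ≤ (p + 1) * b := by positivity
  refine ⟨Real.cos_pos_of_mem_Ioo ⟨by linarith, h1⟩, ?_⟩
  rw [← Real.cos_abs ((p + 1) * β), abs_mul, abs_of_pos hp]
  exact Real.cos_le_cos_of_nonneg_of_le_pi (by positivity) (by linarith [Real.pi_pos])
    (by gcongr)

theorem hasDerivAt_rotatedIntegral {p : ℕ} (hp : 1 ≤ p) (v : ℂ) {β : ℝ}
    (hβ : |β| < Real.pi / (2 * (p + 1))) :
    HasDerivAt (rotatedIntegral p v) 0 β := by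
  -- An intermediate angle b supplies one decay rate `a` valid for all angles near β.
  obtain ⟨b, hb1, hb2⟩ := exists_between hβ
  have hcos := fun γ (hγ : |γ| ≤ b) => cos_pos_of_abs_lt hγ hb2
  set a := Real.cos ((p + 1) * b) / (p + 1) with ha'
  have ha : 0 < a := by have := (hcos β hb1.le).1; positivity
  have hle : ∀ γ, |γ| ≤ b → a ≤ Real.cos ((p + 1) * γ) / (p + 1) := fun γ hγ => by
    rw [ha']; gcongr; exact (hcos γ hγ).2
  have hU : {γ : ℝ | |γ| < b} ∈ 𝓝 β := (isOpen_lt continuous_abs continuous_const).mem_nhds hb1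
  have key := hasDerivAt_integral_of_dominated_loc_of_deriv_le
    (μ := volume.restrict (Ioi (0 : ℝ))) (bound := rotatedBound p v a)
    (F := fun (γ t : ℝ) => cexp (γ * I) *
      cexp (-((cexp (γ * I) * t) ^ (p + 1) / (p + 1)) + v * (cexp (γ * I) * t)))
    (F' := fun (γ t : ℝ) => I * rotatedDeriv p v γ t) (x₀ := β) hU
    (Eventually.of_forall fun γ => Continuous.aestronglyMeasurable (by fun_prop)) ?_
    (Continuous.aestronglyMeasurable (by unfold rotatedDeriv; fun_prop)) ?_
    (integrable_rotatedBound p v ha).integrableOn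
    (Eventually.of_forall fun t γ _ => hasDerivAt_rotated_angle p v γ t)
  · have h0 : ∫ t in Ioi (0 : ℝ), I * rotatedDeriv p v β t = 0 := by
      rw [integral_const_mul, integral_rotatedDeriv hp v, mul_zero]
      have := hcos β hb1.le
      linarith [this.1, this.2]
    rw [h0] at key
    exact key.2
  · have := (integrableOn_kernel hp (A := cexp (((p + 1) * β : ℝ) * I) / (p + 1)) (by
      rw [re_rotated_coeff]; linarith [hle β hb1.le]) (v * cexp (β * I))).const_mul (cexp (β * I))
    refine this.congr (Eventually.of_forall fun t => ?_)
    simp only [rotated_exponent]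
  · filter_upwards [ae_restrict_mem measurableSet_Ioi] with t ht γ hγ
    rw [norm_mul, norm_I, one_mul]
    exact norm_rotatedDeriv_le hp v ha (hle γ (le_of_lt hγ)) (le_of_lt ht)

theorem rotatedIntegral_eq {p : ℕ} (hp : 1 ≤ p) (v : ℂ) {β : ℝ}
    (hβ : |β| < Real.pi / (2 * (p + 1))) :
    rotatedIntegral p v β = rotatedIntegral p v 0 := by
  have hs : IsPreconnected (Ioo (-(Real.pi / (2 * ((p : ℝ) + 1)))) (Real.pi / (2 * (p + 1)))) :=
    isPreconnected_Ioo
  have h0 : 0 < Real.pi / (2 * ((p : ℝ) + 1)) := by positivity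
  refine isOpen_Ioo.is_const_of_deriv_eq_zero hs
    (fun γ hγ => (hasDerivAt_rotatedIntegral hp v
      (abs_lt.2 hγ)).differentiableAt.differentiableWithinAt)
    (fun γ hγ => (hasDerivAt_rotatedIntegral hp v (abs_lt.2 hγ)).deriv)
    (abs_lt.1 hβ) ⟨by linarith, h0⟩

/-- Rotating the path through the saddle point `r = ζ` and rescaling. -/
theorem rotatedIntegral_zero_eq_saddle {p : ℕ} (hp : 1 ≤ p) {ζ : ℂ} (hζ : ζ ≠ 0)
    (harg : |arg ζ| < Real.pi / (2 * (p + 1))) :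
    rotatedIntegral p (ζ ^ p) 0 = ζ * cexp (p / (p + 1) * ζ ^ (p + 1)) *
      ∫ w in Ioi (0 : ℝ), cexp (-(ζ ^ (p + 1) *
        (((w ^ (p + 1) / (p + 1) - w + p / (p + 1) : ℝ)) : ℂ))) := by
  rw [← rotatedIntegral_eq hp _ harg, rotatedIntegral]
  have hn : 0 < ‖ζ‖ := norm_pos_iff.2 hζ
  have := integral_comp_mul_left_Ioi (fun t : ℝ => cexp (arg ζ * I) *
    cexp (-((cexp (arg ζ * I) * t) ^ (p + 1) / (p + 1)) + ζ ^ p * (cexp (arg ζ * I) * t))) 0 hn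
  rw [mul_zero] at this
  rw [eq_inv_smul_iff₀ hn.ne'] at this
  rw [← this, real_smul, ← integral_const_mul, ← integral_const_mul]
  refine integral_congr_ae (Eventually.of_forall fun w => ?_)
  have h1 : cexp (arg ζ * I) * ((‖ζ‖ * w : ℝ) : ℂ) = ζ * w := by
    conv_rhs => rw [← norm_mul_exp_arg_mul_I ζ]
    push_cast; ring
  have h2 : (‖ζ‖ : ℂ) * cexp (arg ζ * I) = ζ := norm_mul_exp_arg_mul_I ζ
  simp only [h1]
  rw [← mul_assoc, h2, mul_assoc ζ, ← Complex.exp_add]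
  congr 2
  push_cast
  have : (p : ℂ) + 1 ≠ 0 := by exact_mod_cast p.succ_ne_zero
  field_simp
  ring

/-! ### Taylor remainder of the exponential. -/

theorem hasDerivAt_expTaylor (M : ℕ) (x : ℂ) :
    HasDerivAt (fun x : ℂ => ∑ k ∈ Finset.range (M + 1), x ^ k / (k.factorial : ℂ))
      (∑ k ∈ Finset.range M, x ^ k / (k.factorial : ℂ)) x := by
  induction M with
  | zero => simpa using hasDerivAt_const x (1 : ℂ)
  | succ M ih =>
    simp only [Finset.sum_range_succ _ (M + 1), Finset.sum_range_succ _ M] at ih ⊢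
    refine ih.add (((hasDerivAt_pow (M + 1) x).div_const _).congr_deriv ?_)
    have : (M : ℂ) + 1 ≠ 0 := by exact_mod_cast M.succ_ne_zero
    have : (M.factorial : ℂ) ≠ 0 := by exact_mod_cast M.factorial_ne_zero
    rw [Nat.factorial_succ]
    push_cast
    field_simp

/-- Each remainder is a primitive of the previous one, so the mean value inequality on the segment
[0, x] gives the induction; there Re(tx) ≤ max(0, Re x). The factor max(1, e^{Re x}) avoids e^{|x|},
which a Gaussian could not absorb. -/
theorem norm_exp_sub_taylor_le (M : ℕ) (x : ℂ) :
    ‖cexp x - ∑ k ∈ Finset.range M, x ^ k / (k.factorial : ℂ)‖ ≤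
      ‖x‖ ^ M * max 1 (Real.exp x.re) := by
  induction M generalizing x with
  | zero => simp [norm_exp]
  | succ M ih =>
    have hb : ∀ y ∈ segment ℝ 0 x,
        ‖cexp y - ∑ k ∈ Finset.range M, y ^ k / (k.factorial : ℂ)‖ ≤
          ‖x‖ ^ M * max 1 (Real.exp x.re) := by
      intro y hy
      obtain ⟨t, ⟨ht0, ht1⟩, rfl⟩ := (segment_eq_image ℝ (0 : ℂ) x) ▸ hy
      refine (ih _).trans ?_
      have h1 : ‖(1 - t) • (0 : ℂ) + t • x‖ ≤ ‖x‖ := by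
        rw [smul_zero, zero_add, norm_smul, Real.norm_of_nonneg ht0]
        exact mul_le_of_le_one_left (norm_nonneg _) ht1
      have h2 : max 1 (Real.exp ((1 - t) • (0 : ℂ) + t • x).re) ≤ max 1 (Real.exp x.re) := by
        refine max_le (le_max_left _ _) ?_
        rw [smul_zero, zero_add, real_smul, re_ofReal_mul]
        rcases le_total 0 x.re with h | h
        · exact le_max_of_le_right (Real.exp_le_exp.2 (mul_le_of_le_one_left h ht1))
        · exact le_max_of_le_left (Real.exp_le_one_iff.2 (mul_nonpos_of_nonneg_of_nonpos ht0 h))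
      gcongr
    have := (convex_segment (𝕜 := ℝ) (0 : ℂ) x).norm_image_sub_le_of_norm_hasDerivWithin_le
      (f := fun y => cexp y - ∑ k ∈ Finset.range (M + 1), y ^ k / (k.factorial : ℂ))
      (fun y _ => ((Complex.hasDerivAt_exp y).sub (hasDerivAt_expTaylor M y)).hasDerivWithinAt)
      hb (left_mem_segment ℝ 0 x) (right_mem_segment ℝ 0 x)
    simp only [Finset.sum_range_succ' _ M] at this ⊢
    simp only [Complex.exp_zero, sub_zero] at this
    refine (le_of_eq ?_).trans (this.trans (le_of_eq ?_))
    · simp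
    · ring

/-! ### Gaussian moments. -/

open Polynomial

theorem integrable_poly_gauss (P : ℝ[X]) {b : ℝ} (hb : 0 < b) :
    Integrable fun x : ℝ => P.eval x * Real.exp (-b * x ^ 2) := by
  induction P using Polynomial.induction_on' with
  | add p q hp hq =>
    exact (hp.add hq).congr (Eventually.of_forall fun x => by simp [add_mul])
  | monomial n a => simpa [mul_assoc] using (integrable_pow_mul_gauss hb n).const_mul a

theorem integrable_abs_poly_gauss (P : ℝ[X]) {b : ℝ} (hb : 0 < b) :
    Integrable fun x : ℝ => |P.eval x| * Real.exp (-b * x ^ 2) := by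
  simpa [abs_mul, abs_of_pos (Real.exp_pos _)] using (integrable_poly_gauss P hb).abs

theorem norm_cgauss (b : ℂ) (x : ℝ) :
    ‖cexp (-b * (x : ℂ) ^ 2)‖ = Real.exp (-b.re * x ^ 2) := by
  rw [norm_exp, ← ofReal_pow, re_mul_ofReal, neg_re]

theorem integrable_poly_cgauss (P : ℝ[X]) {b : ℂ} (hb : 0 < b.re) :
    Integrable fun x : ℝ => ((P.eval x : ℝ) : ℂ) * cexp (-b * (x : ℂ) ^ 2) := by
  refine (integrable_abs_poly_gauss P hb).mono' (Continuous.aestronglyMeasurable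
    ((continuous_ofReal.comp P.continuous).mul (by fun_prop)))
    (Eventually.of_forall fun x => ?_)
  rw [norm_mul, norm_cgauss, norm_real, Real.norm_eq_abs]

theorem hasDerivAt_pow_mul_cgauss (b : ℂ) (n : ℕ) (x : ℝ) :
    HasDerivAt (fun x : ℝ => (x : ℂ) ^ n * cexp (-b * (x : ℂ) ^ 2))
      (n * (x : ℂ) ^ (n - 1) * cexp (-b * (x : ℂ) ^ 2) -
        2 * b * ((x : ℂ) ^ (n + 1) * cexp (-b * (x : ℂ) ^ 2))) x := by
  have h1 := (((hasDerivAt_pow 2 (x : ℂ)).const_mul (-b)).cexp)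
  have h2 := ((hasDerivAt_pow n (x : ℂ)).mul h1).comp_ofReal
  refine HasDerivAt.congr_deriv h2 ?_
  simp
  ring

theorem integrable_pow_mul_cgauss {b : ℂ} (hb : 0 < b.re) (n : ℕ) :
    Integrable fun x : ℝ => (x : ℂ) ^ n * cexp (-b * (x : ℂ) ^ 2) := by
  simpa using integrable_poly_cgauss (X ^ n) hb

/-- Integration by parts. For n = 0 the truncated exponent n - 1 is harmless, its factor n being
zero. -/
theorem moment_recurrence {b : ℂ} (hb : 0 < b.re) (n : ℕ) :
    2 * b * ∫ x : ℝ, (x : ℂ) ^ (n + 1) * cexp (-b * (x : ℂ) ^ 2) =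
      n * ∫ x : ℝ, (x : ℂ) ^ (n - 1) * cexp (-b * (x : ℂ) ^ 2) := by
  have i1 := (integrable_pow_mul_cgauss hb (n - 1)).const_mul (n : ℂ)
  have i2 := (integrable_pow_mul_cgauss hb (n + 1)).const_mul (2 * b)
  have h := integral_eq_zero_of_hasDerivAt_of_integrable
    (fun x => hasDerivAt_pow_mul_cgauss b n x)
    (by simpa only [mul_assoc, Pi.sub_def] using i1.sub i2) (integrable_pow_mul_cgauss hb n)
  simp only [mul_assoc (n : ℂ)] at h
  rw [integral_sub i1 i2, integral_const_mul, integral_const_mul] at h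
  exact (sub_eq_zero.1 h).symm

theorem moment_odd {b : ℂ} (hb : 0 < b.re) (m : ℕ) :
    ∫ x : ℝ, (x : ℂ) ^ (2 * m + 1) * cexp (-b * (x : ℂ) ^ 2) = 0 := by
  have hb0 : (2 * b) ≠ 0 := mul_ne_zero two_ne_zero (fun h => by simp [h] at hb)
  induction m with
  | zero =>
    have := moment_recurrence hb 0
    simpa [hb0] using this
  | succ m ih =>
    have := moment_recurrence hb (2 * m + 2)
    rw [show 2 * m + 2 - 1 = 2 * m + 1 by omega, ih, mul_zero] at this
    exact (mul_eq_zero.1 this).resolve_left hb0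

/-- The coefficients of the even moments of a Gaussian. -/
noncomputable def momentCoeff : ℕ → ℂ
  | 0 => 1
  | m + 1 => (2 * m + 1) / 2 * momentCoeff m

theorem moment_even {b : ℂ} (hb : 0 < b.re) (m : ℕ) :
    ∫ x : ℝ, (x : ℂ) ^ (2 * m) * cexp (-b * (x : ℂ) ^ 2) =
      momentCoeff m * b⁻¹ ^ m * ∫ x : ℝ, cexp (-b * (x : ℂ) ^ 2) := by
  have hb0 : b ≠ 0 := fun h => by simp [h] at hb
  induction m with
  | zero => simp [momentCoeff]
  | succ m ih =>
    have := moment_recurrence hb (2 * m + 1)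
    rw [show 2 * m + 1 - 1 = 2 * m by omega, ih] at this
    rw [show 2 * (m + 1) = 2 * m + 1 + 1 by ring, momentCoeff]
    rw [← mul_right_inj' (mul_ne_zero two_ne_zero hb0), this, pow_succ]
    push_cast
    field_simp

/-- The moment of degree 2k + 2m is a multiple of Z^{-(k+m)} times the Gaussian integral, and odd
moments vanish. After multiplication by Z^k only powers Z^{-m} with m ≥ 0 remain, with no
half-integer ones. -/
theorem exists_poly_moment {h₀ : ℝ} (hh : 0 < h₀) (k : ℕ) (Q : ℝ[X]) :
    ∃ P : ℂ[X], P.coeff 0 = momentCoeff k * (h₀ : ℂ)⁻¹ ^ k * Q.coeff 0 ∧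
      ∀ Z : ℂ, 0 < Z.re →
        Z ^ k * ∫ x : ℝ, (((X ^ (2 * k) * Q).eval x : ℝ) : ℂ) * cexp (-(Z * h₀) * (x : ℂ) ^ 2) =
          (∫ x : ℝ, cexp (-(Z * h₀) * (x : ℂ) ^ 2)) * P.eval Z⁻¹ := by
  have hre : ∀ Z : ℂ, 0 < Z.re → 0 < (Z * h₀).re := fun Z hZ => by
    rw [re_mul_ofReal]; positivity
  induction Q using Polynomial.induction_on' with
  | add p q hp hq =>
    obtain ⟨P₁, h1, h1'⟩ := hp
    obtain ⟨P₂, h2, h2'⟩ := hq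
    refine ⟨P₁ + P₂, by rw [coeff_add, coeff_add, h1, h2]; push_cast; ring, fun Z hZ => ?_⟩
    rw [eval_add, mul_add (∫ x : ℝ, _), ← h1' Z hZ, ← h2' Z hZ, ← mul_add,
      ← integral_add (integrable_poly_cgauss _ (hre Z hZ)) (integrable_poly_cgauss _ (hre Z hZ))]
    congr 2
    ext x
    rw [mul_add, eval_add]
    push_cast
    ring
  | monomial i a =>
    have hpull : ∀ Z : ℂ, ∫ x : ℝ, (((X ^ (2 * k) * monomial i a).eval x : ℝ) : ℂ) *
        cexp (-(Z * h₀) * (x : ℂ) ^ 2) =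
        a * ∫ x : ℝ, (x : ℂ) ^ (2 * k + i) * cexp (-(Z * h₀) * (x : ℂ) ^ 2) := fun Z => by
      rw [← integral_const_mul]
      congr 1
      ext x
      simp
      ring
    rcases Nat.even_or_odd' i with ⟨m, rfl | rfl⟩
    · refine ⟨monomial m (a * momentCoeff (k + m) * (h₀ : ℂ)⁻¹ ^ (k + m)), ?_, fun Z hZ => ?_⟩
      · rcases Nat.eq_zero_or_pos m with rfl | hm
        · simp; ring
        · rw [coeff_monomial_of_ne _ (by omega), coeff_monomial_of_ne _ (by omega)]; simp
      · have hZ0 : Z ≠ 0 := fun h => by simp [h] at hZ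
        rw [hpull, ← mul_add, moment_even (hre Z hZ), eval_monomial, mul_inv, mul_pow, pow_add Z⁻¹]
        have : Z ^ k * Z⁻¹ ^ k = 1 := by rw [← mul_pow, mul_inv_cancel₀ hZ0, one_pow]
        linear_combination (a * momentCoeff (k + m) * (h₀ : ℂ)⁻¹ ^ (k + m) * Z⁻¹ ^ m *
          ∫ x : ℝ, cexp (-(Z * h₀) * (x : ℂ) ^ 2)) * this
    · refine ⟨0, ?_, fun Z hZ => ?_⟩
      · rw [coeff_monomial_of_ne _ (by omega)]; simp
      · rw [hpull, ← add_assoc, ← mul_add, moment_odd (hre Z hZ)]; simp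

theorem integral_abs_pow_gauss_scale (c : ℝ) (n : ℕ) {s : ℝ} (hs : 0 < s) :
    ∫ x : ℝ, |x| ^ n * Real.exp (-(c * s ^ 2) * x ^ 2) =
      s⁻¹ ^ (n + 1) * ∫ x : ℝ, |x| ^ n * Real.exp (-c * x ^ 2) := by
  have := Measure.integral_comp_mul_left (fun x : ℝ => |x| ^ n * Real.exp (-c * x ^ 2)) s
  rw [abs_of_pos (inv_pos.2 hs), smul_eq_mul] at this
  rw [pow_succ s⁻¹, mul_assoc, ← this, ← integral_const_mul]
  congr 1
  ext x
  rw [abs_mul, abs_of_pos hs, mul_pow, ← mul_assoc, ← mul_assoc, inv_pow,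
    inv_mul_cancel₀ (by positivity), one_mul]
  ring_nf

/-- A monomial of degree d contributes s^{-(d+1)} by scaling; for s ≥ 1 the lowest possible degree n
dominates. -/
theorem exists_integral_abs_poly_gauss_le {c : ℝ} (hc : 0 < c) (n : ℕ) (Q : ℝ[X]) :
    ∃ C, 0 ≤ C ∧ ∀ s : ℝ, 1 ≤ s →
      ∫ x : ℝ, |(X ^ n * Q).eval x| * Real.exp (-(c * s ^ 2) * x ^ 2) ≤ C * s⁻¹ ^ (n + 1) := by
  induction Q using Polynomial.induction_on' with
  | add p q hp hq =>
    obtain ⟨C₁, h1, h1'⟩ := hp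
    obtain ⟨C₂, h2, h2'⟩ := hq
    refine ⟨C₁ + C₂, by positivity, fun s hs => ?_⟩
    have hcs : 0 < c * s ^ 2 := by positivity
    rw [add_mul]
    refine le_trans ?_ (add_le_add (h1' s hs) (h2' s hs))
    rw [← integral_add (integrable_abs_poly_gauss _ hcs) (integrable_abs_poly_gauss _ hcs)]
    refine integral_mono (integrable_abs_poly_gauss _ hcs)
      ((integrable_abs_poly_gauss _ hcs).add (integrable_abs_poly_gauss _ hcs)) fun x => ?_
    rw [← add_mul, mul_add, eval_add]
    gcongr
    exact abs_add_le _ _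
  | monomial i a =>
    refine ⟨|a| * ∫ x : ℝ, |x| ^ (n + i) * Real.exp (-c * x ^ 2),
      mul_nonneg (abs_nonneg _) (integral_nonneg fun x => by positivity), fun s hs => ?_⟩
    have hs0 : 0 < s := by positivity
    have e : ∫ x : ℝ, |(X ^ n * monomial i a).eval x| * Real.exp (-(c * s ^ 2) * x ^ 2) =
        |a| * ∫ x : ℝ, |x| ^ (n + i) * Real.exp (-(c * s ^ 2) * x ^ 2) := by
      rw [← integral_const_mul]
      congr 1
      ext x
      simp [abs_mul, abs_pow]
      ring
    rw [e, integral_abs_pow_gauss_scale c _ hs0, mul_left_comm, mul_comm]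
    refine mul_le_mul_of_nonneg_left ?_
      (mul_nonneg (abs_nonneg _) (integral_nonneg fun x => by positivity))
    exact pow_le_pow_of_le_one (by positivity) (inv_le_one_of_one_le₀ hs) (by omega)

/-! ### Laplace's method. -/

/-- The coefficient polynomial of `Z^k x^(2k)` in the Taylor expansion of `exp (-Z x³ Q(x))`. -/
noncomputable def expTerm (Q : ℝ[X]) (k : ℕ) : ℝ[X] := C (k.factorial : ℝ)⁻¹ * (-(X * Q)) ^ k

theorem expTerm_eval (Q : ℝ[X]) (k : ℕ) (Z : ℂ) (x : ℝ) :
    (-(Z * ((x ^ 2 * (x * Q.eval x) : ℝ) : ℂ))) ^ k / (k.factorial : ℂ) =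
      Z ^ k * (((X ^ (2 * k) * expTerm Q k).eval x : ℝ) : ℂ) := by
  simp only [expTerm, eval_mul, eval_pow, eval_X, eval_neg, eval_C]
  push_cast
  rw [pow_mul, neg_pow, neg_pow ((x : ℂ) * _), mul_pow, mul_pow]
  ring

theorem coeff_zero_expTerm (Q : ℝ[X]) (k : ℕ) :
    (expTerm Q k).coeff 0 = if k = 0 then 1 else 0 := by
  rcases k with _ | k
  · simp [expTerm]
  · simp [expTerm, coeff_zero_eq_eval_zero]

/-- With H = h₀ + xQ, the integrand is e^{-Zh₀x²} e^y, y = -Zx³Q, and only e^y is expanded. The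
Gaussian times max(1, e^{Re y}) is the larger of e^{-Re Z·h₀x²} and e^{-Re Z·x²H(x)}, and both are
at most e^{-κh₁|Z|x²}. -/
theorem norm_laplace_remainder_le (H : ℝ[X]) {h₁ κ : ℝ} (M : ℕ) {Z : ℂ} {x : ℝ} (hh : 0 ≤ h₁)
    (hκ : 0 ≤ κ) (hH : h₁ ≤ H.eval x) (h0 : h₁ ≤ H.coeff 0) (hZ : κ * ‖Z‖ ≤ Z.re) :
    ‖cexp (-(Z * ((x ^ 2 * H.eval x : ℝ) : ℂ))) - ∑ k ∈ Finset.range M,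
      Z ^ k * ((((X ^ (2 * k) * expTerm H.divX k).eval x : ℝ) : ℂ) *
        cexp (-(Z * (H.coeff 0 : ℝ)) * (x : ℂ) ^ 2))‖ ≤
      ‖Z‖ ^ M * (|(X ^ (3 * M) * H.divX ^ M).eval x| *
        Real.exp (-(κ * h₁ * ‖Z‖) * x ^ 2)) := by
  set h₀ := H.coeff 0
  set Q := H.divX with hQ
  set y : ℂ := -(Z * ((x ^ 2 * (x * Q.eval x) : ℝ) : ℂ)) with hy
  have hHx : H.eval x = x * Q.eval x + h₀ := by
    conv_lhs => rw [← divX_mul_X_add H]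
    simp only [eval_add, eval_mul, eval_X, eval_C]
    rw [mul_comm]
  have e1 : cexp (-(Z * ((x ^ 2 * H.eval x : ℝ) : ℂ))) - ∑ k ∈ Finset.range M,
      Z ^ k * ((((X ^ (2 * k) * expTerm Q k).eval x : ℝ) : ℂ) *
        cexp (-(Z * (h₀ : ℝ)) * (x : ℂ) ^ 2)) = cexp (-(Z * (h₀ : ℝ)) * (x : ℂ) ^ 2) *
        (cexp y - ∑ k ∈ Finset.range M, y ^ k / (k.factorial : ℂ)) := by
    rw [mul_sub, ← Complex.exp_add, Finset.mul_sum]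
    congr 1
    · rw [hHx, hy]; push_cast; ring_nf
    · refine Finset.sum_congr rfl fun k _ => ?_
      rw [hy, expTerm_eval]; ring
  have hZ0 : 0 ≤ Z.re := le_trans (by positivity) hZ
  have hyn : ‖y‖ ^ M = ‖Z‖ ^ M * |(X ^ (3 * M) * Q ^ M).eval x| := by
    rw [hy, norm_neg, norm_mul, norm_real, Real.norm_eq_abs, mul_pow, ← abs_pow]
    congr 2
    simp; ring
  have hyre : y.re = -(Z.re * (x ^ 2 * (x * Q.eval x))) := by
    rw [hy, neg_re, re_mul_ofReal]
  have hg : ‖cexp (-(Z * (h₀ : ℝ)) * (x : ℂ) ^ 2)‖ = Real.exp (-(Z.re * h₀) * x ^ 2) := by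
    rw [norm_cgauss, re_mul_ofReal]
  have hx2 : κ * ‖Z‖ * x ^ 2 ≤ Z.re * x ^ 2 := by gcongr
  have hgen : ∀ c, h₁ ≤ c → κ * h₁ * ‖Z‖ * x ^ 2 ≤ Z.re * x ^ 2 * c := fun c hc => by
    calc κ * h₁ * ‖Z‖ * x ^ 2 = κ * ‖Z‖ * x ^ 2 * h₁ := by ring
      _ ≤ Z.re * x ^ 2 * c := by gcongr
  rw [e1, norm_mul, hg]
  refine (mul_le_mul_of_nonneg_left (norm_exp_sub_taylor_le M y) (Real.exp_pos _).le).trans ?_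
  rw [mul_left_comm, hyn, mul_assoc]
  refine mul_le_mul_of_nonneg_left (mul_le_mul_of_nonneg_left ?_ (abs_nonneg _)) (by positivity)
  rw [mul_max_of_nonneg _ _ (Real.exp_pos _).le, mul_one, ← Real.exp_add, hyre]
  refine max_le ?_ ?_ <;> rw [Real.exp_le_exp]
  · linarith [hgen _ h0]
  · have := hgen _ hH
    rw [hHx] at this
    linarith

/-- Laplace's method with a polynomial phase that is positive on the path of integration. -/
theorem laplace_expansion (H : ℝ[X]) {h₁ : ℝ} (hh : 0 < h₁) (hH : ∀ x, -1 ≤ x → h₁ ≤ H.eval x)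
    (N : ℕ) :
    ∃ P : ℂ[X], (1 ≤ N → P.coeff 0 = 1) ∧ ∀ κ > 0, ∃ C, 0 ≤ C ∧ ∀ Z : ℂ, 1 ≤ ‖Z‖ →
      κ * ‖Z‖ ≤ Z.re →
      ‖(∫ x in Ioi (-1 : ℝ), cexp (-(Z * ((x ^ 2 * H.eval x : ℝ) : ℂ)))) -
        (∫ x : ℝ, cexp (-(Z * (H.coeff 0 : ℝ)) * (x : ℂ) ^ 2)) * P.eval Z⁻¹‖ ≤
        C * (√‖Z‖)⁻¹ ^ (2 * N + 1) := by
  set h₀ := H.coeff 0 with hh₀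
  have h01 : h₁ ≤ h₀ := by
    rw [hh₀, coeff_zero_eq_eval_zero]; exact hH 0 (by norm_num)
  have h0 : 0 < h₀ := hh.trans_le h01
  set Q := H.divX with hQ
  choose P hP0 hP using fun k => exists_poly_moment h0 k (expTerm Q k)
  -- Each Taylor term gains only |Z|^{-1/2}, since |Z|^k |x|^{3k} scales like |Z|^{-k/2}; hence 2N
  -- terms for the relative order |Z|^{-N}.
  refine ⟨∑ k ∈ Finset.range (2 * N), P k, fun hN => ?_, fun κ hκ => ?_⟩
  · rw [finsetSum_coeff, Finset.sum_eq_single 0]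
    · rw [hP0, coeff_zero_expTerm]; simp [momentCoeff]
    · intro k _ hk
      rw [hP0, coeff_zero_expTerm, if_neg hk]; simp
    · intro h; exact absurd (Finset.mem_range.2 (by omega)) h
  obtain ⟨C₀, hC₀, hC₀'⟩ := exists_integral_abs_poly_gauss_le (mul_pos hκ hh) (3 * (2 * N))
    (Q ^ (2 * N))
  choose D hD hD' using fun k => exists_integral_abs_poly_gauss_le (mul_pos hκ h0) (2 * N + 2 * k)
    (expTerm Q k)
  refine ⟨C₀ + ∑ k ∈ Finset.range (2 * N), D k,
    add_nonneg hC₀ (Finset.sum_nonneg fun k _ => hD k), fun Z hZ1 hZ => ?_⟩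
  set s := √‖Z‖ with hs
  have hs2 : s ^ 2 = ‖Z‖ := Real.sq_sqrt (norm_nonneg _)
  have hs1 : 1 ≤ s := by rw [hs, Real.one_le_sqrt]; exact hZ1
  have hs0 : 0 < s := by positivity
  have hZre : 0 < Z.re := lt_of_lt_of_le (by positivity) hZ
  have hb : 0 < (Z * h₀).re := by rw [re_mul_ofReal]; positivity
  set T : ℕ → ℝ → ℂ := fun k x => Z ^ k * ((((X ^ (2 * k) * expTerm Q k).eval x : ℝ) : ℂ) *
    cexp (-(Z * h₀) * (x : ℂ) ^ 2)) with hT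
  have hTint : ∀ k, Integrable (T k) := fun k => (integrable_poly_cgauss _ hb).const_mul _
  set R : ℝ → ℂ := fun x => cexp (-(Z * ((x ^ 2 * H.eval x : ℝ) : ℂ))) -
    ∑ k ∈ Finset.range (2 * N), T k x with hR
  have hκZ : 0 < κ * h₁ * ‖Z‖ := by positivity
  have hRle : ∀ x ∈ Ioi (-1 : ℝ), ‖R x‖ ≤ ‖Z‖ ^ (2 * N) *
      (|(X ^ (3 * (2 * N)) * Q ^ (2 * N)).eval x| * Real.exp (-(κ * h₁ * ‖Z‖) * x ^ 2)) :=
    fun x hx => norm_laplace_remainder_le H (2 * N) hh.le hκ.le (hH x (le_of_lt hx)) h01 hZ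
  have hBint := ((integrable_abs_poly_gauss (X ^ (3 * (2 * N)) * Q ^ (2 * N)) hκZ).const_mul
    (‖Z‖ ^ (2 * N)))
  have hTcont : ∀ k, Continuous (T k) := fun k =>
    continuous_const.mul ((continuous_ofReal.comp (Polynomial.continuous _)).mul (by fun_prop))
  have hRcont : Continuous R := by
    refine Continuous.sub ?_ (continuous_finsetSum _ fun k _ => hTcont k)
    have : Continuous fun x : ℝ => H.eval x := H.continuous
    fun_prop
  have hRint : IntegrableOn R (Ioi (-1)) :=
    hBint.integrableOn.mono' hRcont.aestronglyMeasurable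
      ((ae_restrict_mem measurableSet_Ioi).mono hRle)
  have hsplit : (∫ x in Ioi (-1 : ℝ), cexp (-(Z * ((x ^ 2 * H.eval x : ℝ) : ℂ)))) =
      (∫ x in Ioi (-1 : ℝ), R x) + ∑ k ∈ Finset.range (2 * N), ∫ x in Ioi (-1 : ℝ), T k x := by
    rw [← integral_finsetSum _ fun k _ => (hTint k).integrableOn, ← integral_add hRint
      (integrable_finsetSum _ fun k _ => (hTint k).integrableOn)]
    congr 1
    ext x
    simp [hR]
  have hTfull : ∀ k, ∫ x in Ioi (-1 : ℝ), T k x =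
      (∫ x : ℝ, cexp (-(Z * h₀) * (x : ℂ) ^ 2)) * (P k).eval Z⁻¹ -
        ∫ x in Iic (-1 : ℝ), T k x := fun k => by
    rw [← hP k Z hZre, ← integral_const_mul, eq_sub_iff_add_eq, add_comm, ← compl_Iic,
      integral_add_compl measurableSet_Iic (hTint k)]
  have hRbound : ‖∫ x in Ioi (-1 : ℝ), R x‖ ≤ C₀ * s⁻¹ ^ (2 * N + 1) := by
    refine (norm_integral_le_of_norm_le hBint.integrableOn
      ((ae_restrict_mem measurableSet_Ioi).mono hRle)).trans ?_
    refine (setIntegral_le_integral hBint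
      (Eventually.of_forall fun x => by positivity)).trans ?_
    rw [integral_const_mul, ← hs2]
    refine (mul_le_mul_of_nonneg_left (hC₀' s hs1) (by positivity)).trans (le_of_eq ?_)
    have : (s ^ 2) ^ (2 * N) * s⁻¹ ^ (4 * N) = 1 := by
      rw [← pow_mul, show 2 * (2 * N) = 4 * N by ring, ← mul_pow, mul_inv_cancel₀ hs0.ne', one_pow]
    rw [show 3 * (2 * N) + 1 = 4 * N + (2 * N + 1) by ring, pow_add s⁻¹]
    linear_combination (C₀ * s⁻¹ ^ (2 * N + 1)) * this
  have hTbound : ∀ k, ‖∫ x in Iic (-1 : ℝ), T k x‖ ≤ D k * s⁻¹ ^ (2 * N + 1) := fun k => by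
    have hκ0 : 0 < κ * h₀ * ‖Z‖ := by positivity
    have hi := (integrable_abs_poly_gauss (X ^ (2 * N + 2 * k) * expTerm Q k) hκ0).const_mul
      (‖Z‖ ^ k)
    -- On the added tail |x| ≥ 1, so a factor |x|^{2N} can be inserted; by scaling it yields the
    -- required decay.
    have hle : ∀ x ∈ Iic (-1 : ℝ), ‖T k x‖ ≤ ‖Z‖ ^ k *
        (|(X ^ (2 * N + 2 * k) * expTerm Q k).eval x| *
          Real.exp (-(κ * h₀ * ‖Z‖) * x ^ 2)) := fun x hx => by
      have hx1 : 1 ≤ |x| := by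
        rw [abs_of_nonpos (by linarith [mem_Iic.1 hx])]; linarith [mem_Iic.1 hx]
      rw [hT, norm_mul, norm_mul, norm_pow, norm_real, Real.norm_eq_abs, norm_cgauss,
        re_mul_ofReal]
      refine mul_le_mul_of_nonneg_left (mul_le_mul ?_ ?_ (Real.exp_pos _).le (abs_nonneg _))
        (by positivity)
      · rw [pow_add, mul_assoc, eval_mul (p := X ^ (2 * N)), abs_mul]
        refine le_mul_of_one_le_left (abs_nonneg _) ?_
        rw [eval_pow, eval_X, abs_pow]
        exact one_le_pow₀ hx1
      · rw [Real.exp_le_exp]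
        have : κ * ‖Z‖ * (h₀ * x ^ 2) ≤ Z.re * (h₀ * x ^ 2) := by gcongr
        linarith
    refine (norm_integral_le_of_norm_le hi.integrableOn
      ((ae_restrict_mem measurableSet_Iic).mono hle)).trans ?_
    refine (setIntegral_le_integral hi (Eventually.of_forall fun x => by positivity)).trans ?_
    rw [integral_const_mul, ← hs2]
    refine (mul_le_mul_of_nonneg_left (hD' k s hs1) (by positivity)).trans (le_of_eq ?_)
    have : (s ^ 2) ^ k * s⁻¹ ^ (2 * k) = 1 := by
      rw [← pow_mul, ← mul_pow, mul_inv_cancel₀ hs0.ne', one_pow]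
    rw [show 2 * N + 2 * k + 1 = 2 * k + (2 * N + 1) by ring, pow_add s⁻¹]
    linear_combination (D k * s⁻¹ ^ (2 * N + 1)) * this
  rw [hsplit, Finset.sum_congr rfl fun k _ => hTfull k, Finset.sum_sub_distrib, eval_finsetSum,
    Finset.mul_sum]
  rw [show ∀ a b c : ℂ, a + (b - c) - b = a - c by intros; ring, add_mul, Finset.sum_mul]
  exact (norm_sub_le _ _).trans (add_le_add hRbound
    ((norm_sum_le _ _).trans (Finset.sum_le_sum fun k _ => hTbound k)))

/-! ### The phase polynomial and the saddle integral. -/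

/-- The double root at w = 1 is divided out with nonnegative quotient coefficients. This gives both
the positivity of the phase and Young's inequality `pow_mul_le_young`. -/
theorem sum_mul_pow_mul_sub_one_sq (p : ℕ) (w : ℝ) :
    (∑ i ∈ Finset.range p, ((p : ℝ) - i) * w ^ i) * (w - 1) ^ 2 =
      w ^ (p + 1) - (p + 1) * w + p := by
  induction p with
  | zero => simp
  | succ p ih =>
    have h : ∑ i ∈ Finset.range (p + 1), (((p + 1 : ℕ) : ℝ) - i) * w ^ i =
        ∑ i ∈ Finset.range p, ((p : ℝ) - i) * w ^ i + ∑ i ∈ Finset.range (p + 1), w ^ i := by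
      rw [Finset.sum_range_succ, Finset.sum_range_succ _ p, ← add_assoc, ← Finset.sum_add_distrib]
      push_cast
      congr 1
      · exact Finset.sum_congr rfl fun i _ => by ring
      · ring
    have hg := geom_sum_mul w (p + 1)
    rw [h]
    push_cast
    linear_combination ih + (w - 1) * hg

/-- The polynomial `H` with `x² H(x) = w^(p+1)/(p+1) - w + p/(p+1)` for `w = x + 1`. -/
noncomputable def phasePoly (p : ℕ) : ℝ[X] :=
  C ((p : ℝ) + 1)⁻¹ * ∑ i ∈ Finset.range p, C ((p : ℝ) - i) * (X + 1) ^ i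

theorem phasePoly_eval (p : ℕ) (x : ℝ) :
    (phasePoly p).eval x =
      ((p : ℝ) + 1)⁻¹ * ∑ i ∈ Finset.range p, ((p : ℝ) - i) * (x + 1) ^ i := by
  simp [phasePoly, eval_finsetSum]

theorem sq_mul_phasePoly_eval (p : ℕ) (x : ℝ) :
    x ^ 2 * (phasePoly p).eval x = (x + 1) ^ (p + 1) / (p + 1) - (x + 1) + p / (p + 1) := by
  have h := sum_mul_pow_mul_sub_one_sq p (x + 1)
  rw [phasePoly_eval]
  have : (p : ℝ) + 1 ≠ 0 := by positivity
  field_simp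
  linear_combination h

theorem phasePoly_coeff_zero (p : ℕ) : (phasePoly p).coeff 0 = p / 2 := by
  rw [coeff_zero_eq_eval_zero, phasePoly_eval]
  have h : ∑ i ∈ Finset.range p, ((p : ℝ) - i) = p * (p + 1) / 2 := by
    induction p with
    | zero => simp
    | succ p ih =>
      rw [Finset.sum_range_succ', ← Finset.sum_congr rfl fun i _ => show (p : ℝ) - i =
        ((p + 1 : ℕ) : ℝ) - ((i + 1 : ℕ) : ℝ) by push_cast; ring, ih]
      push_cast
      ring
  have : (p : ℝ) + 1 ≠ 0 := by positivity
  simp only [zero_add, one_pow, mul_one, h]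
  field_simp

/-- All summands are nonnegative for x + 1 ≥ 0, and the one with i = 0 equals p. -/
theorem phasePoly_lower_bound {p : ℕ} (hp : 1 ≤ p) {x : ℝ} (hx : -1 ≤ x) :
    (p : ℝ) / (p + 1) ≤ (phasePoly p).eval x := by
  rw [phasePoly_eval, div_eq_inv_mul]
  refine mul_le_mul_of_nonneg_left ?_ (by positivity)
  have h := Finset.single_le_sum (f := fun i : ℕ => ((p : ℝ) - i) * (x + 1) ^ i)
    (s := Finset.range p) (fun i hi => mul_nonneg (sub_nonneg.2 (by
      exact_mod_cast (Finset.mem_range.1 hi).le)) (pow_nonneg (by linarith) _))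
    (Finset.mem_range.2 (by omega : 0 < p))
  simpa using h

/-- The integral through the saddle point, normalized to have the value `0` of the phase there. -/
noncomputable def saddleIntegral (p : ℕ) (Z : ℂ) : ℂ :=
  ∫ w in Ioi (0 : ℝ), cexp (-(Z * ((w ^ (p + 1) / (p + 1) - w + p / (p + 1) : ℝ) : ℂ)))

theorem saddleIntegral_eq (p : ℕ) (Z : ℂ) : saddleIntegral p Z =
    ∫ x in Ioi (-1 : ℝ), cexp (-(Z * ((x ^ 2 * (phasePoly p).eval x : ℝ) : ℂ))) := by
  have h := (measurePreserving_add_right volume (1 : ℝ)).setIntegral_preimage_emb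
    (measurableEmbedding_addRight 1)
    (fun w : ℝ => cexp (-(Z * ((w ^ (p + 1) / (p + 1) - w + p / (p + 1) : ℝ) : ℂ)))) (Ioi 0)
  rw [preimage_add_const_Ioi, zero_sub] at h
  rw [saddleIntegral, ← h]
  simp only [sq_mul_phasePoly_eval]

/-- The leading factor `√(2π/(pZ))` of `saddleIntegral`. -/
noncomputable def saddleGauss (p : ℕ) (Z : ℂ) : ℂ := (Real.pi / (Z * (p / 2 : ℝ))) ^ (1 / 2 : ℂ)

theorem norm_saddleGauss (p : ℕ) (Z : ℂ) :
    ‖saddleGauss p Z‖ = √(Real.pi / (p / 2)) * (√‖Z‖)⁻¹ := by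
  have h : (1 / 2 : ℂ) = ((1 / 2 : ℝ) : ℂ) := by push_cast; rfl
  rw [saddleGauss, h, norm_cpow_real, ← Real.sqrt_eq_rpow, norm_div, norm_mul, norm_real, norm_real,
    Real.norm_of_nonneg Real.pi_pos.le, Real.norm_of_nonneg (by positivity), ← Real.sqrt_inv,
    ← Real.sqrt_mul (by positivity)]
  congr 1
  rw [mul_comm ‖Z‖, ← div_div, div_eq_mul_inv _ ‖Z‖]

theorem saddle_poly_expansion {p : ℕ} (hp : 1 ≤ p) (N : ℕ) :
    ∃ P : ℂ[X], (1 ≤ N → P.coeff 0 = 1) ∧ ∀ κ > 0, ∃ C, 0 ≤ C ∧ ∀ Z : ℂ, 1 ≤ ‖Z‖ →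
      κ * ‖Z‖ ≤ Z.re →
      ‖saddleIntegral p Z / saddleGauss p Z - P.eval Z⁻¹‖ ≤ C * ‖Z‖⁻¹ ^ N := by
  have hp0 : (0 : ℝ) < p := by exact_mod_cast hp
  obtain ⟨P, hP, h⟩ := laplace_expansion (phasePoly p) (h₁ := p / (p + 1)) (by positivity)
    (fun x hx => phasePoly_lower_bound hp hx) N
  refine ⟨P, hP, fun κ hκ => ?_⟩
  obtain ⟨C, hC, h⟩ := h κ hκ
  refine ⟨C * (√(Real.pi / (p / 2)))⁻¹, by positivity, fun Z hZ1 hZ => ?_⟩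
  have h := h Z hZ1 hZ
  have hZ0 : 0 < ‖Z‖ := by linarith
  have hre : 0 < (Z * ((p / 2 : ℝ) : ℂ)).re := by
    rw [re_mul_ofReal]
    have : 0 < Z.re := lt_of_lt_of_le (by positivity) hZ
    positivity
  rw [← saddleIntegral_eq, phasePoly_coeff_zero, integral_gaussian_complex hre] at h
  change ‖_ - saddleGauss p Z * _‖ ≤ _ at h
  have hs : 0 < √‖Z‖ := Real.sqrt_pos.2 hZ0
  have hpi : 0 < √(Real.pi / (p / 2)) := Real.sqrt_pos.2 (by positivity)
  have hg : 0 < ‖saddleGauss p Z‖ := by rw [norm_saddleGauss]; positivity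
  have hg0 : saddleGauss p Z ≠ 0 := norm_pos_iff.1 hg
  have e : saddleIntegral p Z / saddleGauss p Z - P.eval Z⁻¹ =
      (saddleIntegral p Z - saddleGauss p Z * P.eval Z⁻¹) / saddleGauss p Z := by
    field_simp
  rw [e, norm_div, div_le_iff₀ hg, norm_saddleGauss]
  refine h.trans (le_of_eq ?_)
  rw [pow_succ, pow_mul, inv_pow, Real.sq_sqrt hZ0.le]
  field_simp

/-! ### One coefficient sequence for all orders. -/

theorem coeff_eq_zero_of_eval_inv_le (N : ℕ) (D : ℂ[X]) (C : ℝ)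
    (h : ∀ t : ℝ, 1 ≤ t → ‖D.eval ((t : ℂ)⁻¹)‖ ≤ C * t⁻¹ ^ N) : ∀ j < N, D.coeff j = 0 := by
  induction N generalizing D with
  | zero => intro j hj; omega
  | succ N ih =>
    have h0 : D.coeff 0 = 0 := by
      have h1 : Tendsto (fun t : ℝ => D.eval ((t : ℂ)⁻¹)) atTop (𝓝 (D.eval 0)) := by
        refine (D.continuous.tendsto 0).comp ?_
        have := (continuous_ofReal.tendsto 0).comp tendsto_inv_atTop_zero
        simpa [Function.comp_def] using this
      have h2 : Tendsto (fun t : ℝ => C * t⁻¹ ^ (N + 1)) atTop (𝓝 0) := by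
        simpa using (tendsto_inv_atTop_zero.pow (N + 1)).const_mul C
      rw [coeff_zero_eq_eval_zero]
      refine tendsto_nhds_unique h1 (squeeze_zero_norm' ?_ h2)
      filter_upwards [eventually_ge_atTop 1] with t ht using h t ht
    have hD : D = D.divX * X := by
      conv_lhs => rw [← divX_mul_X_add D, h0, map_zero, add_zero]
    have := ih D.divX fun t ht => by
      have ht0 : 0 < t := by linarith
      have := h t ht
      rw [hD, eval_mul, eval_X, norm_mul, norm_inv, norm_real, Real.norm_of_nonneg ht0.le,
        pow_succ, ← mul_assoc] at this
      exact le_of_mul_le_mul_right this (inv_pos.2 ht0)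
    intro j hj
    rcases j with _ | j
    · exact h0
    · rw [← coeff_divX]
      exact this j (by omega)

theorem exists_eval_sub_sum_le (P : ℂ[X]) (N : ℕ) : ∃ C, 0 ≤ C ∧ ∀ w : ℂ, ‖w‖ ≤ 1 →
    ‖P.eval w - ∑ k ∈ Finset.range N, P.coeff k * w ^ k‖ ≤ C * ‖w‖ ^ N := by
  refine ⟨∑ j ∈ Finset.range (P.natDegree + 1), ‖P.coeff (N + j)‖, by positivity, fun w hw => ?_⟩
  rw [eval_eq_sum_range' (n := N + (P.natDegree + 1)) (by omega), Finset.sum_range_add,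
    add_sub_cancel_left, Finset.sum_mul]
  refine (norm_sum_le _ _).trans (Finset.sum_le_sum fun j _ => ?_)
  rw [norm_mul, norm_pow]
  exact mul_le_mul_of_nonneg_left (pow_le_pow_of_le_one (norm_nonneg _) hw (by omega))
    (norm_nonneg _)

/-- The Laplace polynomials depend on the order N, but two of them approximate the same function on
the positive axis, so they agree below the smaller order. The k-th coefficient can therefore be read
off at order k + 1. -/
theorem exists_saddle_coeff {p : ℕ} (hp : 1 ≤ p) : ∃ c : ℕ → ℂ, c 0 = 1 ∧
    ∀ N : ℕ, ∀ κ > 0, ∃ C, 0 ≤ C ∧ ∀ Z : ℂ, 1 ≤ ‖Z‖ → κ * ‖Z‖ ≤ Z.re →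
      ‖saddleIntegral p Z / saddleGauss p Z - ∑ k ∈ Finset.range N, c k * Z⁻¹ ^ k‖ ≤
        C * ‖Z‖⁻¹ ^ N := by
  choose P hP0 hP using fun N => saddle_poly_expansion hp N
  have hcoeff : ∀ N k, k < N → (P N).coeff k = (P (k + 1)).coeff k := by
    intro N k hk
    obtain ⟨C₁, hC₁, h₁⟩ := hP N 1 one_pos
    obtain ⟨C₂, hC₂, h₂⟩ := hP (k + 1) 1 one_pos
    have := coeff_eq_zero_of_eval_inv_le (k + 1) (P N - P (k + 1)) (C₁ + C₂) (fun t ht => by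
      have ht0 : 0 < t := by linarith
      have e : ‖(t : ℂ)‖ = t := by rw [norm_real, Real.norm_of_nonneg ht0.le]
      have a₁ := h₁ t (by rwa [e]) (by rw [e]; simp)
      have a₂ := h₂ t (by rwa [e]) (by rw [e]; simp)
      rw [e] at a₁ a₂
      have a₃ : C₁ * t⁻¹ ^ N ≤ C₁ * t⁻¹ ^ (k + 1) := mul_le_mul_of_nonneg_left
        (pow_le_pow_of_le_one (by positivity) (inv_le_one_of_one_le₀ ht) hk) hC₁
      rw [eval_sub]
      refine (norm_sub_le_norm_sub_add_norm_sub _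
        (saddleIntegral p t / saddleGauss p t) _).trans ?_
      rw [norm_sub_rev]
      linarith) k (by omega)
    rwa [coeff_sub, sub_eq_zero] at this
  refine ⟨fun k => (P (k + 1)).coeff k, hP0 1 le_rfl, fun N κ hκ => ?_⟩
  obtain ⟨C₁, hC₁, h₁⟩ := hP N κ hκ
  obtain ⟨C₂, hC₂, h₂⟩ := exists_eval_sub_sum_le (P N) N
  refine ⟨C₁ + C₂, by positivity, fun Z hZ1 hZ => ?_⟩
  have a₁ := h₁ Z hZ1 hZ
  have a₂ := h₂ Z⁻¹ (by rw [norm_inv]; exact inv_le_one_of_one_le₀ hZ1)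
  rw [Finset.sum_congr rfl fun k hk => by rw [hcoeff N k (Finset.mem_range.1 hk)]] at a₂
  rw [norm_inv] at a₂
  refine (norm_sub_le_norm_sub_add_norm_sub _ ((P N).eval Z⁻¹) _).trans ?_
  linarith

/-- The integral along the path through the saddle point, with the leading factor made explicit. -/
theorem rotatedIntegral_zero_eq_main {p : ℕ} (hp : 1 ≤ p) {ζ : ℂ} (hζ : ζ ≠ 0)
    (harg : |arg ζ| < Real.pi / (2 * (p + 1))) :
    rotatedIntegral p (ζ ^ p) 0 = √(2 * Real.pi / p) * cexp (-((p - 1) / 2) * log ζ) *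
      cexp (p / (p + 1) * ζ ^ (p + 1)) *
      (saddleIntegral p (ζ ^ (p + 1)) / saddleGauss p (ζ ^ (p + 1))) := by
  have hp0 : (0 : ℝ) < p := by exact_mod_cast hp
  have hg : saddleGauss p (ζ ^ (p + 1)) =
      √(2 * Real.pi / p) * cexp (-((p + 1) / 2) * log ζ) := by
    have e1 : (Real.pi / (ζ ^ (p + 1) * (p / 2 : ℝ)) : ℂ) =
        cexp ((Real.log (2 * Real.pi / p) : ℝ) - (p + 1) * log ζ) := by
      have e2 : cexp ((p + 1) * log ζ) = ζ ^ (p + 1) := by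
        rw [show ((p : ℂ) + 1) = ((p + 1 : ℕ) : ℂ) by push_cast; rfl, Complex.exp_nat_mul,
          exp_log hζ]
      rw [Complex.exp_sub, e2, ← ofReal_exp, Real.exp_log (by positivity)]
      have : (p : ℂ) ≠ 0 := by exact_mod_cast hp0.ne'
      push_cast
      field_simp
    have him : ((Real.log (2 * Real.pi / p) : ℝ) - (p + 1) * log ζ : ℂ).im =
        -((p + 1) * arg ζ) := by
      have : ((p : ℂ) + 1) = ((p + 1 : ℝ) : ℂ) := by push_cast; rfl
      rw [sub_im, ofReal_im, this, im_ofReal_mul, log_im, zero_sub]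
    have hlt : |(p + 1) * arg ζ| < Real.pi / 2 := by
      rw [abs_mul, abs_of_pos (by positivity)]
      rw [lt_div_iff₀ (by positivity)] at harg
      linarith
    have := abs_lt.1 hlt
    -- Since |(p+1) arg ζ| < π/2, the principal logarithm of Z = ζ^{p+1} is (p+1) log ζ, so the
    -- square root has the expected branch.
    rw [saddleGauss, e1, cpow_def_of_ne_zero (Complex.exp_ne_zero _), log_exp
      (by rw [him]; linarith [Real.pi_pos]) (by rw [him]; linarith [Real.pi_pos]), sub_mul,
      sub_eq_add_neg, Complex.exp_add]
    congr 1
    · rw [Real.sqrt_eq_rpow, Real.rpow_def_of_pos (by positivity)]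
      push_cast
      rfl
    · congr 1; ring
  have hs : √(2 * Real.pi / p) ≠ 0 := (Real.sqrt_pos.2 (by positivity)).ne'
  have hg0 : saddleGauss p (ζ ^ (p + 1)) ≠ 0 := by
    rw [hg]
    exact mul_ne_zero (by exact_mod_cast hs) (Complex.exp_ne_zero _)
  have hexp : cexp (-((p - 1) / 2) * log ζ) = ζ * cexp (-((p + 1) / 2) * log ζ) := by
    conv_rhs => rw [← exp_log hζ]
    rw [← Complex.exp_add, exp_log hζ]
    congr 1; ring
  rw [rotatedIntegral_zero_eq_saddle hp hζ harg, hexp]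
  change _ * saddleIntegral p (ζ ^ (p + 1)) = _
  rw [mul_left_comm (√(2 * Real.pi / p) : ℂ), ← hg]
  field_simp

/-! ### Rays off the bisecting one. -/

theorem cos_le_cos_of_mem_Icc {c x : ℝ} (hc : 0 ≤ c) (hx : c ≤ x) (hx' : x ≤ 2 * Real.pi - c) :
    Real.cos x ≤ Real.cos c := by
  rcases le_total x Real.pi with h | h
  · exact Real.cos_le_cos_of_nonneg_of_le_pi hc h hx
  · rw [← Real.cos_two_pi_sub x]
    exact Real.cos_le_cos_of_nonneg_of_le_pi hc (by linarith) (by linarith)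

theorem sector_half_angle_bounds {p : ℕ} (hp : 2 ≤ p) {δ : ℝ}
    (hδ : δ < Real.pi / (p * (p + 1))) :
    p * δ < Real.pi / (p + 1) ∧ δ < Real.pi / (2 * (p + 1)) := by
  have hp' : (2 : ℝ) ≤ p := by exact_mod_cast hp
  have hp0 : (0 : ℝ) < p := by linarith
  constructor
  · rw [lt_div_iff₀ (by positivity)] at hδ ⊢
    linarith
  · refine hδ.trans_le ?_
    gcongr

/-- On the rays other than the bisecting one, a rotation of the path by `±δ` makes the linear part
of the exponent strictly smaller than on the bisecting ray. -/
theorem exists_rotation {p : ℕ} (hp : 2 ≤ p) {δ : ℝ} (hδ0 : 0 ≤ δ)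
    (hδ : δ < Real.pi / (p * (p + 1))) {m : ℤ} (hm : ¬ ((p : ℤ) + 1) ∣ m) :
    ∃ c < Real.cos ((p + 1) * δ), ∀ α, |α| ≤ δ → ∃ β, |β| ≤ δ ∧
      Real.cos (p * α + 2 * Real.pi * m / (p + 1) + β) ≤ c := by
  have hp' : (2 : ℝ) ≤ p := by exact_mod_cast hp
  obtain ⟨h1, h2⟩ := sector_half_angle_bounds hp hδ
  set q := Real.pi / ((p : ℝ) + 1) with hq
  have hq3 : 3 * q ≤ Real.pi := by
    rw [hq, mul_div_assoc', div_le_iff₀ (by positivity)]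
    nlinarith [Real.pi_pos]
  have hq1 : (p + 1) * q = Real.pi := by rw [hq]; field_simp
  have h2δ : 2 * δ ≤ p * δ := by gcongr
  -- Modulo 2π the angle θ keeps the distance 2q - pδ from 0 and 2π; turning by δ towards π
  -- increases this by δ. The result exceeds (p+1)δ exactly when pδ < q. Without the turn only δ <
  -- 2q/(2p+1) would be reached.
  refine ⟨Real.cos (2 * q - p * δ + δ), ?_, fun α hα => ?_⟩
  · exact Real.cos_lt_cos_of_nonneg_of_le_pi (by positivity) (by linarith) (by linarith)
  set r : ℤ := m % (p + 1)
  have hr0 : 1 ≤ r := by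
    have h := Int.emod_nonneg m (show ((p : ℤ) + 1) ≠ 0 by positivity)
    have h' : r ≠ 0 := fun h => hm (Int.dvd_of_emod_eq_zero h)
    have : 0 ≤ r := h
    omega
  have hrp : r ≤ p := by
    have := Int.emod_lt_of_pos m (show (0 : ℤ) < (p : ℤ) + 1 by positivity)
    change r < _ at this
    omega
  have hr0' : (1 : ℝ) ≤ r := by exact_mod_cast hr0
  have hrp' : (r : ℝ) ≤ p := by exact_mod_cast hrp
  set θ := p * α + 2 * q * r with hθ
  have hmr : (m : ℝ) = (p + 1) * ((m / (p + 1) : ℤ) : ℝ) + r := by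
    have := Int.mul_ediv_add_emod m (p + 1)
    exact_mod_cast this.symm
  have hcos : ∀ β, Real.cos (p * α + 2 * Real.pi * m / (p + 1) + β) = Real.cos (θ + β) := by
    intro β
    rw [← Real.cos_add_int_mul_two_pi (θ + β) (m / (p + 1))]
    congr 1
    rw [hθ, hmr, hq]
    field_simp
    ring
  have hq0 : 0 < q := by positivity
  have hα' := abs_le.1 hα
  have hpα1 : -(p * δ) ≤ p * α := by
    have := mul_le_mul_of_nonneg_left hα'.1 (show (0 : ℝ) ≤ p by linarith)
    linarith
  have hpα2 : p * α ≤ p * δ := mul_le_mul_of_nonneg_left hα'.2 (by linarith)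
  have hθ1 : 2 * q - p * δ ≤ θ := by
    have : 2 * q * 1 ≤ 2 * q * r := by gcongr
    linarith
  have hθ2 : θ ≤ 2 * Real.pi - (2 * q - p * δ) := by
    have : 2 * q * r ≤ 2 * q * p := by gcongr
    linarith
  rcases le_total θ Real.pi with h | h
  · refine ⟨δ, (abs_of_nonneg hδ0).le, ?_⟩
    rw [hcos]
    exact cos_le_cos_of_mem_Icc (by linarith) (by linarith) (by linarith)
  · refine ⟨-δ, by rw [abs_neg, abs_of_nonneg hδ0], ?_⟩
    rw [hcos]
    exact cos_le_cos_of_mem_Icc (by linarith) (by linarith) (by linarith)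

theorem pow_mul_le_young (p : ℕ) {ρ t : ℝ} (hρ : 0 < ρ) (ht : 0 ≤ t) :
    ρ ^ p * t ≤ t ^ (p + 1) / (p + 1) + p / (p + 1) * ρ ^ (p + 1) := by
  have h := sum_mul_pow_mul_sub_one_sq p (t / ρ)
  have h0 : 0 ≤ (∑ i ∈ Finset.range p, ((p : ℝ) - i) * (t / ρ) ^ i) * (t / ρ - 1) ^ 2 :=
    mul_nonneg (Finset.sum_nonneg fun i hi => mul_nonneg (sub_nonneg.2 (by
      exact_mod_cast (Finset.mem_range.1 hi).le)) (by positivity)) (sq_nonneg _)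
  rw [h] at h0
  have h1 := mul_nonneg h0 (pow_nonneg hρ.le (p + 1))
  have e : ((t / ρ) ^ (p + 1) - (p + 1) * (t / ρ) + p) * ρ ^ (p + 1) =
      t ^ (p + 1) + p * ρ ^ (p + 1) - (p + 1) * (ρ ^ p * t) := by
    rw [div_pow]
    field_simp
    ring
  rw [e] at h1
  have hp : (0 : ℝ) < p + 1 := by positivity
  have : t ^ (p + 1) / (p + 1) + p / (p + 1) * ρ ^ (p + 1) - ρ ^ p * t =
      (t ^ (p + 1) + p * ρ ^ (p + 1) - (p + 1) * (ρ ^ p * t)) / (p + 1) := by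
    field_simp
  have := div_nonneg h1 hp.le
  linarith

/-- The integral along a ray off the bisecting one is exponentially smaller. -/
theorem exists_norm_rotatedIntegral_le {p : ℕ} (hp : 2 ≤ p) {δ : ℝ} (hδ0 : 0 ≤ δ)
    (hδ : δ < Real.pi / (p * (p + 1))) {m : ℤ} (hm : ¬ ((p : ℤ) + 1) ∣ m) :
    ∃ C, 0 ≤ C ∧ ∃ ε, 0 < ε ∧ ∀ ζ : ℂ, ζ ≠ 0 → |arg ζ| ≤ δ →
      ‖rotatedIntegral p (ζ ^ p * cexp ((2 * Real.pi * m / (p + 1) : ℝ) * I)) 0‖ ≤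
        C * Real.exp (-ε * ‖ζ‖ ^ (p + 1)) * ‖cexp (p / (p + 1) * ζ ^ (p + 1))‖ := by
  obtain ⟨h1, h2⟩ := sector_half_angle_bounds hp hδ
  obtain ⟨c', hc', hrot⟩ := exists_rotation hp hδ0 hδ hm
  set c := Real.cos ((p + 1) * δ) with hc
  have hcpos : 0 < c := (cos_pos_of_abs_lt (abs_of_nonneg hδ0).le h2).1
  have hp0 : (0 : ℝ) < p := by exact_mod_cast (by omega : 0 < p)
  -- The maximum with 0 covers negative c': Young's inequality is later multiplied by κc, which must
  -- be nonnegative. The gap 1 - κ provides both the convergence in t and the exponential gain in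
  -- |ζ|.
  obtain ⟨κ, hκ0, hκ1, hκ⟩ : ∃ κ, 0 ≤ κ ∧ κ < 1 ∧ c' ≤ κ * c := by
    refine ⟨max (c' / c) 0, le_max_right _ _, max_lt ((div_lt_one hcpos).2 hc') one_pos, ?_⟩
    rw [← div_le_iff₀ hcpos]
    exact le_max_left _ _
  set g : ℝ → ℝ := fun t => Real.exp (-((1 - κ) * c / (p + 1) * t ^ (p + 1))) with hg
  have hgint : IntegrableOn g (Ioi 0) := by
    have h := (integrableOn_kernel (p := p) (by omega)
      (A := (((1 - κ) * c / (p + 1) : ℝ) : ℂ)) (by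
        rw [ofReal_re]; have : 0 < 1 - κ := by linarith
        positivity) 0).norm
    refine h.congr (Eventually.of_forall fun t => ?_)
    simp only [zero_mul, add_zero, hg]
    rw [norm_exp, ← ofReal_pow, ← ofReal_mul, ← ofReal_neg, ofReal_re]
  refine ⟨∫ t in Ioi (0 : ℝ), g t, integral_nonneg fun t => (Real.exp_pos _).le,
    (1 - κ) * c * (p / (p + 1)), by have : 0 < 1 - κ := by linarith
                                    positivity, fun ζ hζ harg => ?_⟩
  obtain ⟨β, hβ, hβ'⟩ := hrot (arg ζ) harg
  set v := ζ ^ p * cexp ((2 * Real.pi * m / (p + 1) : ℝ) * I) with hv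
  set ρ := ‖ζ‖ with hρ
  have hρ0 : 0 < ρ := norm_pos_iff.2 hζ
  have hcos := fun γ (hγ : |γ| ≤ δ) => (cos_pos_of_abs_lt hγ h2).2
  have hpolar : ∀ n : ℕ, ζ ^ n = ((ρ ^ n : ℝ) : ℂ) * cexp ((n * arg ζ : ℝ) * I) := fun n => by
    conv_lhs => rw [← norm_mul_exp_arg_mul_I ζ]
    rw [mul_pow, ← Complex.exp_nat_mul, hρ]
    push_cast
    ring_nf
  have hvre : (v * cexp (β * I)).re =
      ρ ^ p * Real.cos (p * arg ζ + 2 * Real.pi * m / (p + 1) + β) := by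
    rw [hv, hpolar, mul_assoc, mul_assoc, ← Complex.exp_add, ← Complex.exp_add, re_ofReal_mul]
    rw [show ((p * arg ζ : ℝ) : ℂ) * I + ((2 * Real.pi * m / (p + 1) : ℝ) * I + β * I) =
      ((p * arg ζ + 2 * Real.pi * m / (p + 1) + β : ℝ) : ℂ) * I by push_cast; ring,
      exp_ofReal_mul_I_re]
  rw [← rotatedIntegral_eq (by omega) v (hβ.trans_lt h2), rotatedIntegral]
  set B := Real.exp (κ * c * (p / (p + 1) * ρ ^ (p + 1))) with hB
  have hle : ∀ t ∈ Ioi (0 : ℝ), ‖cexp (β * I) *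
      cexp (-((cexp (β * I) * t) ^ (p + 1) / (p + 1)) + v * (cexp (β * I) * t))‖ ≤ B * g t := by
    intro t ht
    have ht : 0 < t := ht
    rw [norm_mul, norm_exp_ofReal_mul_I, one_mul, rotated_exponent, norm_exp, hB, hg,
      ← Real.exp_add, Real.exp_le_exp, ← ofReal_pow, add_re, neg_re, re_mul_ofReal, re_mul_ofReal,
      re_rotated_coeff, hvre]
    have a1 : c / (p + 1) * t ^ (p + 1) ≤ Real.cos ((p + 1) * β) / (p + 1) * t ^ (p + 1) := by
      gcongr
      exact hcos β hβ
    have a2 : ρ ^ p * Real.cos (p * arg ζ + 2 * Real.pi * m / (p + 1) + β) * t ≤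
        ρ ^ p * (κ * c) * t := by
      gcongr
      exact hβ'.trans hκ
    have a3 := mul_le_mul_of_nonneg_left (pow_mul_le_young p hρ0 ht.le)
      (mul_nonneg hκ0 hcpos.le)
    have e : κ * c * (t ^ (p + 1) / (p + 1) + p / (p + 1) * ρ ^ (p + 1)) -
        c / (p + 1) * t ^ (p + 1) =
        κ * c * (p / (p + 1) * ρ ^ (p + 1)) + -((1 - κ) * c / (p + 1) * t ^ (p + 1)) := by ring
    linarith
  have hexp : B ≤ Real.exp (-((1 - κ) * c * (p / (p + 1))) * ρ ^ (p + 1)) *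
      ‖cexp (p / (p + 1) * ζ ^ (p + 1))‖ := by
    rw [norm_exp, ← Real.exp_add, hB, Real.exp_le_exp]
    have e1 : (p / (p + 1) : ℂ) = ((p / (p + 1) : ℝ) : ℂ) := by push_cast; rfl
    rw [e1, re_ofReal_mul, hpolar, re_ofReal_mul, exp_ofReal_mul_I_re]
    have := hcos _ harg
    have a : p / (p + 1) * (ρ ^ (p + 1) * c) ≤
        p / (p + 1) * (ρ ^ (p + 1) * Real.cos (((p + 1 : ℕ) : ℝ) * arg ζ)) := by
      push_cast
      gcongr
    linarith
  refine (norm_integral_le_of_norm_le (hgint.const_mul B)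
    ((ae_restrict_mem measurableSet_Ioi).mono hle)).trans ?_
  rw [integral_const_mul, mul_comm, mul_assoc]
  exact mul_le_mul_of_nonneg_left hexp (integral_nonneg fun t => (Real.exp_pos _).le)

/-! ### Reduction of the ray integrals to one kernel. -/

theorem Sgn.val_mul_val (s : Sgn) : s.val * s.val = 1 := by cases s <;> simp [Sgn.val]

/-- The angle `π L / (p+1)` for a signed exponent `L`. -/
noncomputable def signedAngle (p : ℕ) (L : ℤ) : ℝ := Real.pi * L / (p + 1)

theorem rayAngle_eq (p ℓ : ℕ) : rayAngle p ℓ = signedAngle p ℓ := by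
  simp [rayAngle, signedAngle]

theorem neg_rayAngle_eq (p ℓ : ℕ) : -rayAngle p ℓ = signedAngle p (-ℓ) := by
  simp [rayAngle, signedAngle, neg_div]

/-- The signed exponents of the parity that belongs to the sign. -/
def Sgn.Admissible (s : Sgn) (L : ℤ) : Prop := ∃ k : ℤ, L = 2 * k + s.exponent 0

theorem Sgn.admissible_exponent (s : Sgn) (j : ℕ) : s.Admissible (s.exponent j) := by
  cases s
  · exact ⟨j, by simp [Sgn.exponent]⟩
  · exact ⟨j, by simp [Sgn.exponent]⟩

theorem Sgn.admissible_neg_exponent (s : Sgn) (j : ℕ) : s.Admissible (-s.exponent j) := by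
  cases s
  · exact ⟨-j, by simp [Sgn.exponent]⟩
  · exact ⟨-j - 1, by simp [Sgn.exponent]; ring⟩

theorem Sgn.exponent_le {s : Sgn} {p j : ℕ} (hj : j ≤ s.maxIndex p) : s.exponent j ≤ p + 1 := by
  cases s <;> simp only [Sgn.maxIndex, Sgn.exponent] at * <;> omega

theorem Sgn.exponent_injective (s : Sgn) : Function.Injective s.exponent := by
  intro i j h
  cases s <;> simp only [Sgn.exponent] at h <;> omega

theorem Sgn.val_mul_exp {s : Sgn} {L : ℤ} (hL : s.Admissible L) (p : ℕ) :
    s.val * cexp (((p + 1) * signedAngle p L : ℝ) * I) = 1 := by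
  obtain ⟨k, rfl⟩ := hL
  have e : (p + 1) * signedAngle p (2 * k + s.exponent 0) =
      Real.pi * (s.exponent 0 : ℝ) + k * (2 * Real.pi) := by
    rw [signedAngle]
    push_cast
    field_simp
    ring
  rw [e]
  push_cast
  rw [add_mul, mul_assoc (k : ℂ), Complex.exp_add, Complex.exp_int_mul_two_pi_mul_I]
  cases s <;> simp [Sgn.val, Sgn.exponent]

theorem rayIntegrand_eq {s : Sgn} {L : ℤ} (hL : s.Admissible L) (p : ℕ) (u : ℂ) (r : ℝ) :
    rayIntegrand s p u (signedAngle p L) r = cexp (signedAngle p L * I) *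
      cexp (-((1 / (p + 1)) * (r : ℂ) ^ (p + 1)) +
        s.val * u * cexp (signedAngle p L * I) * r) := by
  have h := Sgn.val_mul_exp hL p
  have e : cexp (signedAngle p L * I) ^ (p + 1) =
      cexp (((p + 1) * signedAngle p L : ℝ) * I) := by
    rw [← Complex.exp_nat_mul]; push_cast; ring_nf
  rw [← e] at h
  rw [rayIntegrand, integrand, mul_comm]
  congr 2
  rw [mul_pow]
  linear_combination (-(r : ℂ) ^ (p + 1) / (p + 1)) * h

theorem integrableOn_rayIntegrand {s : Sgn} {L : ℤ} (hL : s.Admissible L) {p : ℕ} (hp : 1 ≤ p)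
    (u : ℂ) : IntegrableOn (rayIntegrand s p u (signedAngle p L)) (Ioi 0) := by
  simp only [IntegrableOn, funext (rayIntegrand_eq hL p u)]
  refine (integrableOn_kernel hp ?_ _).const_mul _
  have : (1 / (p + 1) : ℂ) = ((1 / (p + 1) : ℝ) : ℂ) := by push_cast; rfl
  rw [this, ofReal_re]
  positivity

theorem rayIntegral_eq {s : Sgn} {L : ℤ} (hL : s.Admissible L) (p : ℕ) (u : ℂ) :
    rayIntegral s p u (signedAngle p L) = cexp (signedAngle p L * I) *
      rotatedIntegral p (s.val * u * cexp (signedAngle p L * I)) 0 := by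
  rw [rayIntegral, rotatedIntegral, ← integral_const_mul]
  refine integral_congr_ae (Eventually.of_forall fun r => ?_)
  simp only [rayIntegrand_eq hL]
  simp only [ofReal_zero, zero_mul, Complex.exp_zero, one_mul]
  congr 3
  ring

/-- The coordinate `z e^{-iφ}`, in which the bisecting ray is the positive real axis. -/
noncomputable def unrotate (φ : ℝ) (z : ℂ) : ℂ := z * cexp (-(φ * I))

theorem norm_unrotate (φ : ℝ) (z : ℂ) : ‖unrotate φ z‖ = ‖z‖ := by
  rw [unrotate, ← neg_mul, ← ofReal_neg, norm_mul, norm_exp_ofReal_mul_I, mul_one]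

theorem unrotate_ne_zero {φ : ℝ} {z : ℂ} (hz : z ≠ 0) : unrotate φ z ≠ 0 := by
  rw [← norm_pos_iff, norm_unrotate]; exact norm_pos_iff.2 hz

theorem unrotate_mul (φ : ℝ) (z : ℂ) : unrotate φ z * cexp (φ * I) = z := by
  rw [unrotate, mul_assoc, ← Complex.exp_add]; simp

theorem unrotate_pow_succ {s : Sgn} {L : ℤ} (hL : s.Admissible L) (p : ℕ) (z : ℂ) :
    unrotate (signedAngle p L) z ^ (p + 1) = s.val * z ^ (p + 1) := by
  have h := Sgn.val_mul_exp hL p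
  have e : cexp (signedAngle p L * I) ^ (p + 1) =
      cexp (((p + 1) * signedAngle p L : ℝ) * I) := by
    rw [← Complex.exp_nat_mul]; push_cast; ring_nf
  conv_rhs => rw [← unrotate_mul (signedAngle p L) z, mul_pow, e]
  linear_combination (-unrotate (signedAngle p L) z ^ (p + 1)) * h

/-- The sign cancels against e^{i(p+1)φ}, φ the angle of L: of its p+1 factors e^{iφ}, p come from
z^p and one from the ray of L'. -/
theorem rayIntegral_pow_eq {s : Sgn} {L L' m : ℤ} (hL : s.Admissible L) (hL' : s.Admissible L')
    (hm : L' - L = 2 * m) (p : ℕ) (z : ℂ) :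
    rayIntegral s p (z ^ p) (signedAngle p L') = cexp (signedAngle p L' * I) *
      rotatedIntegral p (unrotate (signedAngle p L) z ^ p *
        cexp ((2 * Real.pi * m / (p + 1) : ℝ) * I)) 0 := by
  rw [rayIntegral_eq hL']
  congr 2
  have h := Sgn.val_mul_exp hL p
  have e : signedAngle p L' = signedAngle p L + 2 * Real.pi * m / (p + 1) := by
    have : (L' : ℝ) = L + 2 * m := by
      rw [sub_eq_iff_eq_add'.1 hm]; push_cast; ring
    rw [signedAngle, signedAngle, this]; ring
  have e2 : cexp (signedAngle p L * I) ^ p * cexp (signedAngle p L * I) =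
      cexp (((p + 1) * signedAngle p L : ℝ) * I) := by
    rw [← pow_succ, ← Complex.exp_nat_mul]; push_cast; ring_nf
  rw [← e2] at h
  conv_lhs => rw [← unrotate_mul (signedAngle p L) z, mul_pow, e, ofReal_add, add_mul,
    Complex.exp_add]
  linear_combination (unrotate (signedAngle p L) z ^ p *
    cexp ((2 * Real.pi * m / (p + 1) : ℝ) * I)) * h

/-! ### Subdominant contributions. -/

/-- The leading factor `z^{-(p-1)/2} exp(± p z^(p+1)/(p+1))`. -/
noncomputable def leadingFactor (s : Sgn) (p : ℕ) (φ : ℝ) (z : ℂ) : ℂ :=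
  branchPow φ (-((p - 1) / 2)) z * cexp (s.val * (p / (p + 1) * z ^ (p + 1)))

theorem leadingFactor_ne_zero (s : Sgn) (p : ℕ) (φ : ℝ) (z : ℂ) : leadingFactor s p φ z ≠ 0 :=
  mul_ne_zero (Complex.exp_ne_zero _) (Complex.exp_ne_zero _)

theorem leadingFactor_eq {s : Sgn} {L : ℤ} (hL : s.Admissible L) (p : ℕ) (z : ℂ) :
    leadingFactor s p (signedAngle p L) z =
      cexp (-((p - 1) / 2) * (signedAngle p L * I)) *
      (cexp (-((p - 1) / 2) * log (unrotate (signedAngle p L) z)) *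
        cexp (p / (p + 1) * unrotate (signedAngle p L) z ^ (p + 1))) := by
  rw [unrotate_pow_succ hL, leadingFactor, branchPow, ← unrotate, mul_add, Complex.exp_add,
    mul_left_comm s.val]
  ring

/-- `R` is `O(z^{-N})` times the leading factor, for all `N`, in all closed subsectors. -/
def Subdominant (s : Sgn) (p : ℕ) (φ : ℝ) (R : ℂ → ℂ) : Prop :=
  ∀ δ < Real.pi / (p * (p + 1)), ∀ N : ℕ,
    (fun z => R z / leadingFactor s p φ z)
      =O[Bornology.cobounded ℂ ⊓ 𝓟 (closedSector φ δ)] fun z => 1 / z ^ N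

theorem Subdominant.add {s : Sgn} {p : ℕ} {φ : ℝ} {R S : ℂ → ℂ} (hR : Subdominant s p φ R)
    (hS : Subdominant s p φ S) : Subdominant s p φ fun z => R z + S z := fun δ hδ N => by
  simpa only [add_div] using (hR δ hδ N).add (hS δ hδ N)

theorem Subdominant.const_mul {s : Sgn} {p : ℕ} {φ : ℝ} {R : ℂ → ℂ} (hR : Subdominant s p φ R)
    (c : ℂ) : Subdominant s p φ fun z => c * R z := fun δ hδ N => by
  simpa only [mul_div_assoc] using (hR δ hδ N).const_mul_left c

theorem Subdominant.sub {s : Sgn} {p : ℕ} {φ : ℝ} {R S : ℂ → ℂ} (hR : Subdominant s p φ R)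
    (hS : Subdominant s p φ S) : Subdominant s p φ fun z => R z - S z := fun δ hδ N => by
  simpa only [sub_div] using (hR δ hδ N).sub (hS δ hδ N)

theorem Subdominant.zero (s : Sgn) (p : ℕ) (φ : ℝ) : Subdominant s p φ fun _ => 0 :=
  fun δ _ N => by simpa only [zero_div] using isBigO_zero _ _

theorem Subdominant.sum {ι : Type*} {s : Sgn} {p : ℕ} {φ : ℝ} {R : ι → ℂ → ℂ} (J : Finset ι)
    (hR : ∀ j ∈ J, Subdominant s p φ (R j)) : Subdominant s p φ fun z => ∑ j ∈ J, R j z :=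
  fun δ hδ N => by
    simpa only [Finset.sum_div] using IsBigO.fun_sum fun j hj => hR j hj δ hδ N

theorem isBigO_of_norm_le {f g : ℂ → ℂ} {S : Set ℂ} (C r : ℝ)
    (h : ∀ z ∈ S, r ≤ ‖z‖ → ‖f z‖ ≤ C * ‖g z‖) : f =O[Bornology.cobounded ℂ ⊓ 𝓟 S] g := by
  refine IsBigO.of_bound C (eventually_inf_principal.2 ?_)
  filter_upwards [tendsto_norm_cobounded_atTop.eventually_ge_atTop r] with z hz hzS
  exact h z hzS hz

theorem exists_pow_mul_exp_neg_le {ε : ℝ} (hε : 0 < ε) (n : ℕ) :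
    ∃ C, 0 ≤ C ∧ ∀ ρ : ℝ, 0 ≤ ρ → ρ ^ n * Real.exp (-ε * ρ) ≤ C := by
  refine ⟨n.factorial / ε ^ n, by positivity, fun ρ hρ => ?_⟩
  have h := Real.pow_div_factorial_le_exp (ε * ρ) (by positivity) n
  rw [neg_mul, Real.exp_neg, ← div_eq_mul_inv, div_le_div_iff₀ (Real.exp_pos _) (by positivity)]
  rw [div_le_iff₀ (by positivity), mul_pow] at h
  linarith

/-- A crude bound suffices, as the exponential gain absorbs any power of |ζ|. -/
theorem norm_exp_neg_log_ge {p : ℕ} (hp : 1 ≤ p) {ζ : ℂ} (hζ : 1 ≤ ‖ζ‖) :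
    1 ≤ ‖ζ‖ ^ p * ‖cexp (-((p - 1) / 2) * log ζ)‖ := by
  have e : (-((p - 1) / 2) : ℂ) = ((-((p - 1) / 2) : ℝ) : ℂ) := by push_cast; rfl
  have hp' : (1 : ℝ) ≤ p := by exact_mod_cast hp
  have hζ0 : 0 < ‖ζ‖ := by linarith
  rw [e, norm_exp, re_ofReal_mul, log_re, ← Real.exp_log (pow_pos hζ0 p), ← Real.exp_add,
    Real.one_le_exp_iff, Real.log_pow]
  have : 0 ≤ Real.log ‖ζ‖ := Real.log_nonneg hζ
  nlinarith

/-- The bound on |L' - L| makes the two rays distinct: exponents differing by 2(p+1) give the same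
ray. -/
theorem subdominant_rayIntegral {s : Sgn} {p : ℕ} (hp : 2 ≤ p) {L L' : ℤ} (hL : s.Admissible L)
    (hL' : s.Admissible L') (hne : L' ≠ L) (hlt : |L' - L| < 2 * (p + 1)) :
    Subdominant s p (signedAngle p L)
      fun z => rayIntegral s p (z ^ p) (signedAngle p L') := by
  intro δ hδ N
  obtain ⟨m, hm⟩ : ∃ m : ℤ, L' - L = 2 * m := by
    obtain ⟨k, hk⟩ := hL
    obtain ⟨k', hk'⟩ := hL'
    exact ⟨k' - k, by rw [hk, hk']; ring⟩
  have hdvd : ¬ ((p : ℤ) + 1) ∣ m := by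
    intro h
    have h1 : |m| < (p : ℤ) + 1 := by
      rw [hm, abs_mul, abs_two] at hlt; omega
    have := Int.eq_zero_of_abs_lt_dvd h h1
    omega
  obtain ⟨C, hC, ε, hε, hb⟩ := exists_norm_rotatedIntegral_le hp (le_max_right δ 0)
    (max_lt hδ (by have : (0 : ℝ) < p := by exact_mod_cast (by omega : 0 < p)
                   positivity)) hdvd
  obtain ⟨K, hK, hKb⟩ := exists_pow_mul_exp_neg_le hε (p + N)
  refine isBigO_of_norm_le (C * K) 1 fun z hz hz1 => ?_
  set ζ := unrotate (signedAngle p L) z with hζ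
  have hz0 : 0 < ‖z‖ := by linarith
  have hζn : ‖ζ‖ = ‖z‖ := norm_unrotate _ _
  have h := hb ζ (unrotate_ne_zero hz.1) (hz.2.trans (le_max_left _ _))
  change ‖rayIntegral s p (z ^ p) (signedAngle p L') / _‖ ≤ _
  rw [leadingFactor_eq hL, rayIntegral_pow_eq hL hL' hm, norm_div, norm_mul, norm_mul, norm_mul,
    norm_exp_ofReal_mul_I, one_mul]
  have e : (-((p - 1) / 2) * (signedAngle p L * I) : ℂ) =
      ((-((p - 1) / 2) * signedAngle p L : ℝ) : ℂ) * I := by push_cast; ring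
  rw [e, norm_exp_ofReal_mul_I, one_mul, norm_div, norm_one, norm_pow]
  rw [← hζ, div_le_iff₀ (mul_pos (norm_pos_iff.2 (Complex.exp_ne_zero _))
    (norm_pos_iff.2 (Complex.exp_ne_zero _)))]
  refine h.trans ?_
  have hlog := norm_exp_neg_log_ge (p := p) (by omega) (ζ := ζ) (by rw [hζn]; exact hz1)
  rw [hζn] at hlog ⊢
  have hKb := hKb (‖z‖ ^ (p + 1)) (by positivity)
  have hpw : ‖z‖ ^ (p + N) ≤ (‖z‖ ^ (p + 1)) ^ (p + N) :=
    pow_le_pow_left₀ hz0.le (le_self_pow₀ hz1 (by omega)) _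
  set E := Real.exp (-ε * ‖z‖ ^ (p + 1))
  set l := ‖cexp (-((p - 1) / 2) * log ζ)‖
  have hE : 0 ≤ E := (Real.exp_pos _).le
  have h1 : ‖z‖ ^ N * E ≤ K * l := by
    calc ‖z‖ ^ N * E ≤ ‖z‖ ^ N * E * (‖z‖ ^ p * l) :=
          le_mul_of_one_le_right (by positivity) hlog
      _ = ‖z‖ ^ (p + N) * E * l := by rw [pow_add]; ring
      _ ≤ (‖z‖ ^ (p + 1)) ^ (p + N) * E * l := by gcongr
      _ ≤ K * l := by gcongr
  have h2 : E ≤ K * (1 / ‖z‖ ^ N) * l := by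
    rw [mul_one_div, div_mul_eq_mul_div, le_div_iff₀ (by positivity)]
    linarith
  calc C * E * ‖cexp (p / (p + 1) * ζ ^ (p + 1))‖
      ≤ C * (K * (1 / ‖z‖ ^ N) * l) * ‖cexp (p / (p + 1) * ζ ^ (p + 1))‖ := by gcongr
    _ = _ := by ring

/-! ### Assembling the expansion. -/

/-- The coefficients of `z^{-i}` that belong to the coefficients `c k` of `(±z^(p+1))^{-k}`. -/
noncomputable def airyCoeff (s : Sgn) (p : ℕ) (c : ℕ → ℂ) (i : ℕ) : ℂ :=
  if (p + 1) ∣ i then c (i / (p + 1)) * s.val ^ (i / (p + 1)) else 0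

theorem sum_airyCoeff (s : Sgn) (p : ℕ) (c : ℕ → ℂ) (z : ℂ) (N : ℕ) :
    ∑ i ∈ Finset.range ((p + 1) * N), airyCoeff s p c i / z ^ i =
      ∑ k ∈ Finset.range N, c k * (s.val * z ^ (p + 1))⁻¹ ^ k := by
  induction N with
  | zero => simp
  | succ N ih =>
    have h0 : ∑ i ∈ Finset.range p, airyCoeff s p c ((p + 1) * N + (i + 1)) /
        z ^ ((p + 1) * N + (i + 1)) = 0 := Finset.sum_eq_zero fun i hi => by
      have : ¬ (p + 1) ∣ (p + 1) * N + (i + 1) := by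
        rw [Nat.dvd_add_right (dvd_mul_right _ _)]
        exact Nat.not_dvd_of_pos_of_lt (by omega) (by have := Finset.mem_range.1 hi; omega)
      rw [airyCoeff, if_neg this, zero_div]
    have hs : s.val⁻¹ = s.val := inv_eq_of_mul_eq_one_left s.val_mul_val
    rw [mul_add, mul_one, Finset.sum_range_add, ih, Finset.sum_range_succ _ N,
      Finset.sum_range_succ' _ p, h0, zero_add, add_zero, airyCoeff, if_pos (dvd_mul_right _ _),
      Nat.mul_div_cancel_left _ (by omega), mul_inv, hs, mul_pow, inv_pow, ← pow_mul]
    ring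

theorem isBigO_expansion_of_le {F : ℂ → ℂ} {a : ℕ → ℂ} {S : Set ℂ} {N M : ℕ} (hNM : N ≤ M)
    (h : (fun z => F z - ∑ i ∈ Finset.range M, a i / z ^ i)
      =O[Bornology.cobounded ℂ ⊓ 𝓟 S] fun z => 1 / z ^ M) :
    (fun z => F z - ∑ i ∈ Finset.range N, a i / z ^ i)
      =O[Bornology.cobounded ℂ ⊓ 𝓟 S] fun z => 1 / z ^ N := by
  have hpow : ∀ n, N ≤ n → (fun z : ℂ => 1 / z ^ n)
      =O[Bornology.cobounded ℂ ⊓ 𝓟 S] fun z => 1 / z ^ N := fun n hn =>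
    isBigO_of_norm_le 1 1 fun z _ hz => by
      rw [norm_div, norm_div, norm_one, norm_pow, norm_pow, one_mul]
      have : 0 < ‖z‖ := by linarith
      gcongr
  have hsum : (fun z : ℂ => ∑ i ∈ Finset.Ico N M, a i / z ^ i)
      =O[Bornology.cobounded ℂ ⊓ 𝓟 S] fun z => 1 / z ^ N :=
    IsBigO.fun_sum fun i hi => by
      simpa only [mul_one_div] using (hpow i (Finset.mem_Ico.1 hi).1).const_mul_left (a i)
  refine ((h.trans (hpow M hNM)).add hsum).congr_left fun z => ?_
  rw [← Finset.sum_range_add_sum_Ico _ hNM]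
  ring

/-- Here η is the orientation sign of the dominant ray and R collects all other rays. The phase
e^{iπL/2} in `hA` is what remains of e^{iφ} once e^{-i(p-1)φ/2} has gone into the branch of
z^{-(p-1)/2}. -/
theorem hasAiryAsymptotics_of_rayIntegral {s : Sgn} {p : ℕ} (hp : 2 ≤ p) {L : ℤ}
    (hL : s.Admissible L) {c : ℕ → ℂ}
    (hc : ∀ N : ℕ, ∀ κ > 0, ∃ C, 0 ≤ C ∧ ∀ Z : ℂ, 1 ≤ ‖Z‖ → κ * ‖Z‖ ≤ Z.re →
      ‖saddleIntegral p Z / saddleGauss p Z - ∑ k ∈ Finset.range N, c k * Z⁻¹ ^ k‖ ≤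
        C * ‖Z‖⁻¹ ^ N) {Φ R : ℂ → ℂ} {A η ε : ℂ}
    (hΦ : ∀ z, Φ (z ^ p) = A * (η * rayIntegral s p (z ^ p) (signedAngle p L) + R z))
    (hR : Subdominant s p (signedAngle p L) R) (hε : ε ≠ 0)
    (hA : A * √(2 * Real.pi / p) * η * cexp (Real.pi * L / 2 * I) = ε) :
    HasAiryAsymptotics s p Φ ε (airyCoeff s p c) (signedAngle p L) := by
  refine ⟨fun z => Φ (z ^ p) / (ε * leadingFactor s p (signedAngle p L) z), fun z _ => ?_,
    fun δ hδ N => ?_⟩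
  · rw [mul_assoc ε, ← leadingFactor, mul_div_cancel₀]
    exact mul_ne_zero hε (leadingFactor_ne_zero _ _ _ _)
  -- Order (p+1)N in 1/z corresponds to exactly N terms in 1/Z; the order N follows by truncation.
  refine isBigO_expansion_of_le (M := (p + 1) * N) (Nat.le_mul_of_pos_left _ (by omega)) ?_
  -- The expansion is required for every δ below the bound, negative ones included.
  have hδ' : max δ 0 < Real.pi / (p * (p + 1)) :=
    max_lt hδ (by have : (0 : ℝ) < p := by exact_mod_cast (by omega : 0 < p)
                  positivity)
  obtain ⟨-, h2⟩ := sector_half_angle_bounds hp hδ'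
  obtain ⟨C, hC, hb⟩ := hc N (Real.cos ((p + 1) * max δ 0))
    (cos_pos_of_abs_lt (abs_of_nonneg (le_max_right δ 0)).le h2).1
  have hmain : ∀ z ∈ closedSector (signedAngle p L) δ,
      Φ (z ^ p) / (ε * leadingFactor s p (signedAngle p L) z) =
        saddleIntegral p (s.val * z ^ (p + 1)) / saddleGauss p (s.val * z ^ (p + 1)) +
          A / ε * (R z / leadingFactor s p (signedAngle p L) z) := by
    intro z hz
    set φ := signedAngle p L with hφ
    have hζ := rotatedIntegral_zero_eq_main (p := p) (by omega)
      (unrotate_ne_zero (φ := φ) hz.1) ((hz.2.trans (le_max_left _ _)).trans_lt h2)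
    have hray : rayIntegral s p (z ^ p) φ = √(2 * Real.pi / p) * cexp (Real.pi * L / 2 * I) *
        leadingFactor s p φ z *
        (saddleIntegral p (s.val * z ^ (p + 1)) / saddleGauss p (s.val * z ^ (p + 1))) := by
      rw [hφ, rayIntegral_pow_eq hL hL (m := 0) (by ring), leadingFactor_eq hL,
        ← unrotate_pow_succ hL]
      rw [show ((2 * Real.pi * ((0 : ℤ) : ℝ) / (p + 1) : ℝ) : ℂ) * I = 0 by simp,
        Complex.exp_zero, mul_one, hζ]
      have : cexp (signedAngle p L * I) = cexp (Real.pi * L / 2 * I) *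
          cexp (-((p - 1) / 2) * (signedAngle p L * I)) := by
        rw [← Complex.exp_add]
        congr 1
        have : (p : ℂ) + 1 ≠ 0 := by exact_mod_cast p.succ_ne_zero
        rw [signedAngle]
        push_cast
        field_simp
        ring
      rw [this]
      ring
    have hl := leadingFactor_ne_zero s p φ z
    rw [hΦ, hray, div_eq_iff (mul_ne_zero hε hl)]
    have e : A / ε * (R z / leadingFactor s p φ z) * (ε * leadingFactor s p φ z) = A * R z := by
      field_simp
    rw [add_mul, e]
    linear_combination (leadingFactor s p φ z * (saddleIntegral p (s.val * z ^ (p + 1)) /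
      saddleGauss p (s.val * z ^ (p + 1)))) * hA
  have hfirst : (fun z : ℂ => saddleIntegral p (s.val * z ^ (p + 1)) /
      saddleGauss p (s.val * z ^ (p + 1)) -
      ∑ i ∈ Finset.range ((p + 1) * N), airyCoeff s p c i / z ^ i)
      =O[Bornology.cobounded ℂ ⊓ 𝓟 (closedSector (signedAngle p L) δ)]
        fun z => 1 / z ^ ((p + 1) * N) := by
    refine isBigO_of_norm_le C 1 fun z hz hz1 => ?_
    rw [sum_airyCoeff, ← unrotate_pow_succ hL]
    set ζ := unrotate (signedAngle p L) z with hζ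
    have hζn : ‖ζ‖ = ‖z‖ := norm_unrotate _ _
    have hpow : ‖ζ ^ (p + 1)‖ = ‖z‖ ^ (p + 1) := by rw [norm_pow, hζn]
    refine (hb (ζ ^ (p + 1)) ?_ ?_).trans (le_of_eq ?_)
    · rw [hpow]; exact one_le_pow₀ hz1
    · have hre : (ζ ^ (p + 1)).re = ‖z‖ ^ (p + 1) * Real.cos ((p + 1) * arg ζ) := by
        conv_lhs => rw [← norm_mul_exp_arg_mul_I ζ, mul_pow, ← Complex.exp_nat_mul, hζn,
          ← ofReal_pow, re_ofReal_mul]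
        rw [← exp_ofReal_mul_I_re]
        push_cast
        ring_nf
      rw [hpow, hre, mul_comm]
      have := (cos_pos_of_abs_lt (hz.2.trans (le_max_left δ 0)) h2).2
      exact mul_le_mul_of_nonneg_left this (by positivity)
    · rw [hpow, norm_div, norm_one, norm_pow, inv_pow, one_div, pow_mul]
  refine (hfirst.add ((hR δ hδ ((p + 1) * N)).const_mul_left (A / ε))).congr' ?_ EventuallyEq.rfl
  filter_upwards [mem_inf_of_right (mem_principal_self _)] with z hz
  rw [hmain z hz]
  ring

/-- The strict lower bound on L matters for the negative real ray, represented by p+1 and never by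
-(p+1). -/
theorem subdominant_contourIntegral {s : Sgn} {p : ℕ} (hp : 2 ≤ p) {L : ℤ} (hL : s.Admissible L)
    (hL1 : -(p + 1 : ℤ) < L) (hL2 : L ≤ p + 1) {j : ℕ} (hj : s.exponent j ≤ p + 1)
    (h1 : (s.exponent j : ℤ) ≠ L) (h2 : -(s.exponent j : ℤ) ≠ L) :
    Subdominant s p (signedAngle p L) fun z => contourIntegral s p (z ^ p) (s.exponent j) := by
  have hj' : (s.exponent j : ℤ) ≤ p + 1 := by exact_mod_cast hj
  have hupper := subdominant_rayIntegral hp hL (s.admissible_exponent j) h1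
    (abs_lt.2 ⟨by omega, by omega⟩)
  by_cases hd : Degenerate p (s.exponent j)
  · simpa only [contourIntegral, if_pos hd, rayAngle_eq] using hupper
  · have hne : s.exponent j ≠ p + 1 := fun h => hd (Or.inr h)
    have hlower := subdominant_rayIntegral hp hL (s.admissible_neg_exponent j) h2
      (abs_lt.2 ⟨by omega, by omega⟩)
    simpa only [contourIntegral, if_neg hd, rayAngle_eq, ← neg_rayAngle_eq] using hupper.sub hlower

theorem prefactor_mul_sqrt {p : ℕ} (hp : 1 ≤ p) (s : Sgn) :
    (s.val * p / (2 * Real.pi)) ^ (1 / 2 : ℂ) * √(2 * Real.pi / p) =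
      cexp (Real.pi * s.exponent 0 / 2 * I) := by
  have hp0 : (0 : ℝ) < p := by exact_mod_cast hp
  have hq : 0 < (p : ℝ) / (2 * Real.pi) := by positivity
  have hsq : (((p / (2 * Real.pi) : ℝ) : ℂ)) ^ (1 / 2 : ℂ) * √(2 * Real.pi / p) = 1 := by
    have : (1 / 2 : ℂ) = ((1 / 2 : ℝ) : ℂ) := by push_cast; rfl
    rw [this, ← ofReal_cpow hq.le, ← Real.sqrt_eq_rpow, ← ofReal_mul, ← Real.sqrt_mul hq.le]
    have : (p : ℝ) / (2 * Real.pi) * (2 * Real.pi / p) = 1 := by field_simp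
    rw [this]; simp
  cases s
  · have : Sgn.plus.val * p / (2 * Real.pi) = ((p / (2 * Real.pi) : ℝ) : ℂ) := by
      simp [Sgn.val]
    rw [this, hsq]
    simp [Sgn.exponent]
  · have : Sgn.minus.val * p / (2 * Real.pi) = ((-(p / (2 * Real.pi)) : ℝ) : ℂ) := by
      simp [Sgn.val, neg_div]
    rw [this, ofReal_cpow_of_nonpos (by linarith), ← ofReal_neg, neg_neg, mul_right_comm, hsq,
      one_mul]
    congr 1
    simp [Sgn.exponent]
    ring

theorem Phi_pow_eq (s : Sgn) (p : ℕ) {J : Finset ℕ} {j : ℕ} (hj : j ∈ J) (u : ℂ) :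
    Phi s p J u = (s.val * p / (2 * Real.pi)) ^ (1 / 2 : ℂ) *
      (contourIntegral s p u (s.exponent j) +
        ∑ i ∈ J.erase j, contourIntegral s p u (s.exponent i)) := by
  rw [Phi, Finset.add_sum_erase J (fun i => contourIntegral s p u (s.exponent i)) hj]

theorem subdominant_sum_erase {s : Sgn} {p : ℕ} (hp : 2 ≤ p) {L : ℤ} (hL : s.Admissible L)
    (hL1 : -(p + 1 : ℤ) < L) (hL2 : L ≤ p + 1) {J : Finset ℕ} (hJ : ∀ j ∈ J, j ≤ s.maxIndex p)
    {j : ℕ} (hj : L = s.exponent j ∨ L = -s.exponent j) :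
    Subdominant s p (signedAngle p L)
      fun z => ∑ i ∈ J.erase j, contourIntegral s p (z ^ p) (s.exponent i) := by
  refine Subdominant.sum _ fun i hi => ?_
  have hne : s.exponent i ≠ s.exponent j := fun h =>
    (Finset.mem_erase.1 hi).1 (s.exponent_injective h)
  exact subdominant_contourIntegral hp hL hL1 hL2
    (Sgn.exponent_le (hJ i (Finset.mem_of_mem_erase hi))) (by omega) (by omega)

theorem Sgn.exp_upper (s : Sgn) (j : ℕ) :
    cexp (Real.pi * s.exponent 0 / 2 * I) * cexp (Real.pi * (s.exponent j : ℤ) / 2 * I) =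
      s.upperSign j := by
  rw [← Complex.exp_add]
  have e : (Real.pi * s.exponent 0 / 2 * I + Real.pi * (s.exponent j : ℤ) / 2 * I : ℂ) =
      ((s.exponent 0 + j : ℕ) : ℂ) * (Real.pi * I) := by
    cases s <;> simp [Sgn.exponent] <;> ring
  rw [e, Complex.exp_nat_mul, Complex.exp_pi_mul_I]
  cases s <;> simp [Sgn.exponent, Sgn.upperSign, add_comm]

/-- The factor -1 is the incoming orientation of the lower ray. -/
theorem Sgn.exp_lower (s : Sgn) (j : ℕ) :
    cexp (Real.pi * s.exponent 0 / 2 * I) * (-1) *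
      cexp (Real.pi * (-s.exponent j : ℤ) / 2 * I) = s.lowerSign j := by
  rw [mul_right_comm, ← Complex.exp_add]
  have e : (Real.pi * s.exponent 0 / 2 * I + Real.pi * (-s.exponent j : ℤ) / 2 * I : ℂ) =
      -((j : ℂ) * (Real.pi * I)) := by
    cases s <;> simp [Sgn.exponent] <;> ring
  rw [e, Complex.exp_neg, Complex.exp_nat_mul, Complex.exp_pi_mul_I, ← inv_pow, inv_neg, inv_one]
  cases s <;> simp [Sgn.lowerSign, pow_succ]

theorem Sgn.upperSign_ne_zero (s : Sgn) (j : ℕ) : s.upperSign j ≠ 0 := by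
  cases s <;> simp [Sgn.upperSign]

theorem Sgn.lowerSign_ne_zero (s : Sgn) (j : ℕ) : s.lowerSign j ≠ 0 := by
  cases s <;> simp [Sgn.lowerSign]

end AiryLike

theorem theorem2p6 (p : ℕ) (hp : 2 ≤ p) (s : Sgn) :
    -- the defining integrals converge absolutely on all the rays
    (∀ j ≤ s.maxIndex p, ∀ u : ℂ,
      IntegrableOn (rayIntegrand s p u (rayAngle p (s.exponent j))) (Ioi 0) ∧
      IntegrableOn (rayIntegrand s p u (-rayAngle p (s.exponent j))) (Ioi 0)) ∧
    -- one sequence of coefficients serves all contours and all sectors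
    ∃ a : ℕ → ℂ, a 0 = 1 ∧ (∀ i, 1 ≤ i → i < (p + 2) / 2 → a i = 0) ∧
      ∀ J : Finset ℕ, (∀ j ∈ J, j ≤ s.maxIndex p) → ∀ j ∈ J,
        HasAiryAsymptotics s p (Phi s p J) (s.upperSign j) a (rayAngle p (s.exponent j)) ∧
        (¬ Degenerate p (s.exponent j) →
          HasAiryAsymptotics s p (Phi s p J) (s.lowerSign j) a (-rayAngle p (s.exponent j))) := by
  refine ⟨fun j _ u => ?_, ?_⟩
  · rw [neg_rayAngle_eq, rayAngle_eq]
    exact ⟨integrableOn_rayIntegrand (s.admissible_exponent j) (by omega) u,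
      integrableOn_rayIntegrand (s.admissible_neg_exponent j) (by omega) u⟩
  obtain ⟨c, hc0, hc⟩ := exists_saddle_coeff (p := p) (by omega)
  refine ⟨airyCoeff s p c, ?_, fun i hi1 hi2 => ?_, fun J hJ j hj => ?_⟩
  · simp [airyCoeff, hc0]
  · rw [airyCoeff, if_neg (Nat.not_dvd_of_pos_of_lt hi1 (by omega))]
  have hexp : (s.exponent j : ℤ) ≤ p + 1 := by exact_mod_cast Sgn.exponent_le (hJ j hj)
  have hupper : s.Admissible (s.exponent j) := s.admissible_exponent j
  have hlower : s.Admissible (-s.exponent j) := s.admissible_neg_exponent j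
  rw [neg_rayAngle_eq, rayAngle_eq]
  constructor
  · have hrest := subdominant_sum_erase hp hupper (by omega) hexp hJ (Or.inl rfl)
    have hA := s.exp_upper j
    rw [← prefactor_mul_sqrt (by omega : 1 ≤ p) s] at hA
    by_cases hd : Degenerate p (s.exponent j)
    · refine hasAiryAsymptotics_of_rayIntegral hp hupper hc (η := 1) (fun z => ?_) hrest
        (s.upperSign_ne_zero j) (by rw [mul_one]; exact hA)
      rw [Phi_pow_eq s p hj, contourIntegral, if_pos hd, rayAngle_eq, one_mul]
    · have hne0 : s.exponent j ≠ 0 := fun h => hd (Or.inl h)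
      have hne1 : s.exponent j ≠ p + 1 := fun h => hd (Or.inr h)
      -- The other ray of the same contour also belongs to the remainder.
      have hself := subdominant_rayIntegral hp hupper hlower (by omega)
        (abs_lt.2 ⟨by omega, by omega⟩)
      refine hasAiryAsymptotics_of_rayIntegral hp hupper hc (η := 1) (fun z => ?_)
        (hrest.sub hself) (s.upperSign_ne_zero j) (by rw [mul_one]; exact hA)
      rw [Phi_pow_eq s p hj, contourIntegral, if_neg hd, neg_rayAngle_eq, rayAngle_eq]
      ring
  · intro hd
    have hne0 : s.exponent j ≠ 0 := fun h => hd (Or.inl h)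
    have hne1 : s.exponent j ≠ p + 1 := fun h => hd (Or.inr h)
    have hrest := subdominant_sum_erase hp hlower (by omega) (by omega) hJ (Or.inr rfl)
    have hself := subdominant_rayIntegral hp hlower hupper (by omega)
      (abs_lt.2 ⟨by omega, by omega⟩)
    have hA := s.exp_lower j
    rw [← prefactor_mul_sqrt (by omega : 1 ≤ p) s] at hA
    refine hasAiryAsymptotics_of_rayIntegral hp hlower hc (η := -1) (fun z => ?_)
      (hself.add hrest) (s.lowerSign_ne_zero j) hA
    rw [Phi_pow_eq s p hj, contourIntegral, if_neg hd, neg_rayAngle_eq, rayAngle_eq]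
    ring
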